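/- Let $\mathbb D$ be the open unit disk, $dA$ Lebesgue measure, $\mu(\Omega)=\int_\Omega (1-|z|^2)^{-2}\,dA(z)$ the hyperbolic measure of $\Omega\subset\mathbb D$. For $\alpha>-1$ let $\mathcal A^2_\alpha$ be the space of holomorphic functions $f$ on $\mathbb D$ with $\|f\|^2_{\mathcal A^2_\alpha}=\frac{\alpha+1}{\pi}\int_{\mathbb D}|f(z)|^2(1-|z|^2)^\alpha\,dA(z)<\infty$. There is an absolute constant $C>0$ such that for every $t_0\in(0,1)$ there exists $T_0\in(t_0,1)$, depending only on $t_0$, with the following property. Let $\alpha>-1$, let $f\in\mathcal A^2_\alpha$ with $\|f\|_{\mathcal A^2_\alpha}=1$, put $u(z)=|f(z)|^2(1-|z|^2)^{\alpha+2}$, let $T=\max_{\mathbb D}u$ and $\rho(t)=\mu(\{z\in\mathbb D:u(z)>t\})$. If $T\ge T_0$, then $$\rho(t)\le \pi\,\frac{1+C\,t_0^{-3}(1-T)}{T}\left(\Big(\frac{T}{t}\Big)^{\frac1{\alpha+2}}-1\right)\qquad\text{for all } t\in(t_0,T).$$ With the same $C$ and $T_0$, the same holds for $u(z)=\sum_{j\ge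 0}p_j|f_j(z)|^2(1-|z|^2)^{\alpha+2}$, where $p_j\ge 0$, $\sum_j p_j=1$, $f_j\in\mathcal A^2_\alpha$ and $\|f_j\|_{\mathcal A^2_\alpha}=1$ for all $j$; in particular for the covariant symbol of a positive semi-definite operator of trace one on $\mathcal A^2_\alpha$. -/

import Mathlib

open MeasureTheory

noncomputable section

/-- The open unit disk. -/
def unitDisk : Set ℂ := Metric.ball (0 : ℂ) 1

/-- Membership in the weighted Bergman space `A²_α`: holomorphic in the disk, with `|f|²`
integrable against `(1 - |z|²)^α dA`. -/
def MemBergman (α : ℝ) (f : ℂ → ℂ) : Prop :=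
  DifferentiableOn ℂ f unitDisk ∧
    IntegrableOn (fun z : ℂ => ‖f z‖ ^ 2 * (1 - ‖z‖ ^ 2) ^ α) unitDisk volume

/-- The norm of the weighted Bergman space `A²_α`. -/
def bergmanNorm (α : ℝ) (f : ℂ → ℂ) : ℝ :=
  Real.sqrt ((α + 1) / Real.pi * ∫ z in unitDisk, ‖f z‖ ^ 2 * (1 - ‖z‖ ^ 2) ^ α)

/-- The hyperbolic measure `dA(z) / (1 - |z|²)²` on the disk. -/
def hyperbolicMeasure : Measure ℂ :=
  (volume.restrict unitDisk).withDensity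
    (fun z : ℂ => ENNReal.ofReal (1 / (1 - ‖z‖ ^ 2) ^ 2))

/-- The function `u(z) = |f(z)|² (1 - |z|²)^(α+2)`. -/
def bergmanDensity (α : ℝ) (f : ℂ → ℂ) (z : ℂ) : ℝ :=
  ‖f z‖ ^ 2 * (1 - ‖z‖ ^ 2) ^ (α + 2)

/-- The function `u(z) = ∑ⱼ pⱼ |fⱼ(z)|² (1 - |z|²)^(α+2)`, the covariant symbol
`⟨κ_z, A κ_z⟩` of the operator `A = ∑ⱼ pⱼ ⟨·, fⱼ⟩ fⱼ`. -/
def covariantSymbol (α : ℝ) (p : ℕ → ℝ) (f : ℕ → ℂ → ℂ) (z : ℂ) : ℝ :=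
  ∑' j, p j * bergmanDensity α (f j) z

/-- The distribution function `ρ(t)`: the hyperbolic measure of `{z ∈ 𝔻 : u(z) > t}`. -/
def superlevelMeasure (u : ℂ → ℝ) (t : ℝ) : ENNReal :=
  hyperbolicMeasure {z : ℂ | z ∈ unitDisk ∧ t < u z}

end

/-! Put `β = α + 2`, `y(z) = (1 - |z|²)^(-β)`, and move the maximum of `u` to the origin by a disk
automorphism, which preserves hyperbolic area and the Bergman norm. Since `‖z^n‖² = 1 / negBinom β
n` in `A²_α`, the symbol becomes `u · y = ‖∑ z^n A_n‖²` with `A_n ∈ ℓ²`, `∑ ‖A_n‖² / negBinom β n ≤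
1` and `‖A_0‖² = T`. The mixture over `j` is thus handled like a single, vector-valued function.

With `s = t / T` and `δ² = (1 - T) / T`, the superlevel set lies in `s y < 1 + h + δ² (y - 1)`. Here
`h` is harmonic of size `O(δ)`, coming from the inner product of `A_0` with the remainder, and the
last term bounds the square of the remainder. A direct estimate of `h` would only give an error of
order `δ`; two facts improve this to `δ²`. Maximality at `0` kills the linear term of `h`
(`inner_eq_zero_of_max`), so along rays `h` is `2δ`-Lipschitz as a function of `y`, uniformly in `β`
(`abs_re_series_sub_le`). Hence `h` may be frozen on the unperturbed circle `y = 1/s` at a cost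
`O(δ²)` (`level_bound_of_perturbation`). On that circle `h` has mean zero, and the area bound is
linear in `h` after Bernoulli's inequality, so the first order contribution integrates to zero
(`hyperbolicMeasure_perturbed_level_le`). -/

noncomputable section

/-! ### Binomial series and weighted Cauchy–Schwarz. -/

/-- The Taylor coefficients of `(1 - x) ^ (-β)`. -/
def negBinom (β : ℝ) (n : ℕ) : ℝ := ∏ k ∈ Finset.range n, (β + k) / (k + 1)

lemma negBinom_zero (β : ℝ) : negBinom β 0 = 1 := by simp [negBinom]

lemma negBinom_succ (β : ℝ) (n : ℕ) :
    negBinom β (n + 1) = negBinom β n * ((β + n) / (n + 1)) := by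
  simp only [negBinom, Finset.prod_range_succ]

lemma negBinom_pos {β : ℝ} (hβ : 0 < β) (n : ℕ) : 0 < negBinom β n :=
  Finset.prod_pos fun k _ => by positivity

lemma succ_mul_negBinom_succ (β : ℝ) (n : ℕ) :
    ((n : ℝ) + 1) * negBinom β (n + 1) = β * negBinom (β + 1) n := by
  induction n with
  | zero => simp [negBinom]
  | succ n ih =>
    rw [negBinom_succ β (n + 1), negBinom_succ (β + 1) n]
    have h1 : ((n : ℝ) + 1) ≠ 0 := by positivity
    have h2 : ((n : ℝ) + 1 + 1) ≠ 0 := by positivity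
    have : negBinom β (n + 1) = β * negBinom (β + 1) n / (n + 1) := by
      rw [← ih]; field_simp
    rw [this]
    push_cast
    field_simp
    ring

lemma hasDerivAt_one_sub_rpow_neg (β : ℝ) {x : ℝ} (hx : x < 1) :
    HasDerivAt (fun x : ℝ => (1 - x) ^ (-β)) (β * (1 - x) ^ (-(β + 1))) x := by
  have h : HasDerivAt (fun x : ℝ => 1 - x) (-1) x := by
    simpa using (hasDerivAt_id x).const_sub 1
  have := h.rpow_const (p := -β) (Or.inl (by linarith))
  convert this using 1
  rw [show -(β + 1) = -β - 1 by ring]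
  ring

/-- Differentiating the partial sum of length `N + 1` for `β` gives `β` times the partial sum of
length `N` for `β + 1`. Induction over all `β` therefore makes the difference of the two sides
monotone, starting from `0` at `x = 0`. -/
lemma sum_negBinom_mul_pow_le (N : ℕ) {β : ℝ} (hβ : 0 < β) {x : ℝ} (hx0 : 0 ≤ x) (hx1 : x < 1) :
    ∑ n ∈ Finset.range N, negBinom β n * x ^ n ≤ (1 - x) ^ (-β) := by
  induction N generalizing β x with
  | zero => simpa using Real.rpow_nonneg (by linarith) _
  | succ N ih =>
    set φ : ℝ → ℝ := fun x => (1 - x) ^ (-β) - ∑ n ∈ Finset.range (N + 1), negBinom β n * x ^ n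
      with hφ
    have hd : ∀ y : ℝ, y < 1 → HasDerivAt φ (β * (1 - y) ^ (-(β + 1)) -
        ∑ n ∈ Finset.range (N + 1), negBinom β n * (n * y ^ (n - 1))) y := by
      intro y hy
      refine (hasDerivAt_one_sub_rpow_neg β hy).sub (HasDerivAt.fun_sum fun n _ => ?_)
      exact (hasDerivAt_pow n y).const_mul _
    have hmono : MonotoneOn φ (Set.Ico 0 1) := by
      refine monotoneOn_of_deriv_nonneg (convex_Ico 0 1)
        (fun y hy => (hd y hy.2).continuousAt.continuousWithinAt)
        (fun y hy => ?_) (fun y hy => ?_)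
      · rw [interior_Ico] at hy
        exact (hd y hy.2).differentiableAt.differentiableWithinAt
      · rw [interior_Ico] at hy
        rw [(hd y hy.2).deriv, Finset.sum_range_succ']
        have := mul_le_mul_of_nonneg_left (ih (β := β + 1) (by linarith) hy.1.le hy.2) hβ.le
        rw [Finset.mul_sum] at this
        have he : ∀ n ∈ Finset.range N, negBinom β (n + 1) * (((n + 1 : ℕ) : ℝ) * y ^ (n + 1 - 1))
            = β * (negBinom (β + 1) n * y ^ n) := by
          intro n _
          rw [← mul_assoc β, ← succ_mul_negBinom_succ, Nat.add_sub_cancel]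
          push_cast; ring
        rw [Finset.sum_congr rfl he]
        simp only [Nat.cast_zero, zero_mul, mul_zero, add_zero]
        linarith
    have h0 : φ 0 = 0 := by
      simp [hφ, Finset.sum_range_succ', negBinom_zero]
    have := hmono (Set.left_mem_Ico.2 one_pos) ⟨hx0, hx1⟩ hx0
    rw [h0] at this
    simpa [hφ] using this

lemma sum_negBinom_succ_mul_pow_le (N : ℕ) {β : ℝ} (hβ : 0 < β) {x : ℝ} (hx0 : 0 ≤ x)
    (hx1 : x < 1) :
    ∑ n ∈ Finset.range N, negBinom β (n + 1) * x ^ (n + 1) ≤ (1 - x) ^ (-β) - 1 := by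
  have := sum_negBinom_mul_pow_le (N + 1) hβ hx0 hx1
  rw [Finset.sum_range_succ'] at this
  simp only [negBinom_zero, pow_zero, mul_one] at this
  linarith

/-- The right side is shaped so that at `x = r²` it is exactly the square of the derivative of `(1 -
r²)^(-β)`. The factor `x` is available only because the sum starts at index two. The proof uses `n +
2 ≤ 2 (n + 1)` and two index shifts, which raise `β` to `β + 2`. -/
lemma sum_sq_mul_negBinom_le (N : ℕ) {β : ℝ} (hβ : 1 ≤ β) {x : ℝ} (hx0 : 0 ≤ x) (hx1 : x < 1) :
    ∑ n ∈ Finset.range N, negBinom β (n + 2) * (((n : ℝ) + 2) ^ 2 * x ^ (n + 1)) ≤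
      4 * β ^ 2 * x * (1 - x) ^ (-(2 * β + 2)) := by
  have h1 : ∀ n : ℕ, negBinom β (n + 2) * (((n : ℝ) + 2) ^ 2 * x ^ (n + 1)) ≤
      2 * β * (β + 1) * x * (negBinom (β + 2) n * x ^ n) := by
    intro n
    have e1 := succ_mul_negBinom_succ β (n + 1)
    have e2 := succ_mul_negBinom_succ (β + 1) n
    push_cast at e1
    have hb := (negBinom_pos (by linarith : 0 < β) (n + 2)).le
    have e3 : ((n : ℝ) + 2) * ((n : ℝ) + 1) * negBinom β (n + 2) =
        β * (β + 1) * negBinom (β + 2) n := by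
      rw [show β + 2 = β + 1 + 1 by ring]
      calc _ = ((n : ℝ) + 1) * (((n : ℝ) + 1 + 1) * negBinom β (n + 1 + 1)) := by ring_nf
        _ = β * (((n : ℝ) + 1) * negBinom (β + 1) (n + 1)) := by rw [e1]; ring
        _ = _ := by rw [e2]; ring
    have hn : (0 : ℝ) ≤ n := n.cast_nonneg
    calc negBinom β (n + 2) * (((n : ℝ) + 2) ^ 2 * x ^ (n + 1))
        ≤ negBinom β (n + 2) * ((2 * (((n : ℝ) + 2) * (n + 1))) * x ^ (n + 1)) := by
          gcongr; nlinarith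
      _ = 2 * (((n : ℝ) + 2) * ((n : ℝ) + 1) * negBinom β (n + 2)) * x * x ^ n := by ring
      _ = _ := by rw [e3]; ring
  have h2 := sum_negBinom_mul_pow_le N (by linarith : 0 < β + 2) hx0 hx1
  calc _ ≤ ∑ n ∈ Finset.range N, 2 * β * (β + 1) * x * (negBinom (β + 2) n * x ^ n) :=
        Finset.sum_le_sum fun n _ => h1 n
    _ = 2 * β * (β + 1) * x * ∑ n ∈ Finset.range N, negBinom (β + 2) n * x ^ n := by
        rw [Finset.mul_sum]
    _ ≤ 2 * β * (β + 1) * x * (1 - x) ^ (-(β + 2)) := by gcongr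
    _ ≤ 2 * β * (β + β) * x * (1 - x) ^ (-(2 * β + 2)) := by
        gcongr ?_ * ?_
        · gcongr
        · exact Real.rpow_le_rpow_of_exponent_ge (by linarith) (by linarith) (by linarith)
    _ = _ := by ring

/-- Weighted Cauchy–Schwarz inequality for series, from bounds on partial sums. -/
lemma summable_and_tsum_mul_le {a b m : ℕ → ℝ} {X Y : ℝ} (ha : ∀ n, 0 ≤ a n) (hb : ∀ n, 0 < b n)
    (hm : ∀ n, 0 ≤ m n) (hX : ∀ N, ∑ n ∈ Finset.range N, a n ^ 2 / b n ≤ X)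
    (hY : ∀ N, ∑ n ∈ Finset.range N, b n * m n ^ 2 ≤ Y) :
    Summable (fun n => a n * m n) ∧ ∑' n, a n * m n ≤ √(X * Y) := by
  have key : ∀ N, ∑ n ∈ Finset.range N, a n * m n ≤ √(X * Y) := by
    intro N
    apply Real.le_sqrt_of_sq_le
    refine (Finset.sum_sq_le_sum_mul_sum_of_sq_le_mul (Finset.range N)
      (f := fun n => a n ^ 2 / b n) (g := fun n => b n * m n ^ 2) ?_ ?_ ?_).trans ?_
    · intro n _; have := hb n; positivity
    · intro n _; have := hb n; positivity
    · intro n _; have := (hb n).ne'; apply le_of_eq; field_simp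
    · refine mul_le_mul (hX N) (hY N) (Finset.sum_nonneg fun n _ => ?_) ?_
      · have := hb n; positivity
      · simpa using hX 0
  exact ⟨summable_of_sum_range_le (fun n => mul_nonneg (ha n) (hm n)) key,
    Real.tsum_le_of_sum_range_le (fun n => mul_nonneg (ha n) (hm n)) key⟩

end

/-! ### The harmonic part along rays and its circular mean. -/

lemma hasDerivAt_one_sub_sq_rpow_neg (β : ℝ) {r : ℝ} (hr : r ^ 2 < 1) :
    HasDerivAt (fun r : ℝ => (1 - r ^ 2) ^ (-β)) (β * (1 - r ^ 2) ^ (-(β + 1)) * (2 * r)) r := by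
  have h2 : HasDerivAt (fun x : ℝ => x ^ 2) (2 * r) r := by simpa using hasDerivAt_pow 2 r
  exact HasDerivAt.comp (h₂ := fun x : ℝ => (1 - x) ^ (-β)) (h := fun x : ℝ => x ^ 2) r
    (hasDerivAt_one_sub_rpow_neg β hr) h2

/-- Cauchy–Schwarz against the weights `negBinom β (n + 2)`: the radial derivative of the series is
dominated by `δ` times that of `(1 - r²)^(-β)`. -/
lemma norm_rotated_series_deriv_le {β δ : ℝ} (hβ : 1 ≤ β) (hδ : 0 ≤ δ) {c : ℕ → ℂ}
    (hc : ∀ N, ∑ n ∈ Finset.range N, ‖c n‖ ^ 2 / negBinom β (n + 2) ≤ δ ^ 2)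
    {r : ℝ} (hr0 : 0 ≤ r) (hr1 : r < 1) :
    Summable (fun n => ‖c n‖ * (((n : ℝ) + 2) * r ^ (n + 1))) ∧
    ∑' n, ‖c n‖ * (((n : ℝ) + 2) * r ^ (n + 1)) ≤
      δ * (β * (1 - r ^ 2) ^ (-(β + 1)) * (2 * r)) := by
  have hr2 : r ^ 2 < 1 := by nlinarith
  have h := summable_and_tsum_mul_le (a := fun n => ‖c n‖) (b := fun n => negBinom β (n + 2))
    (m := fun n => ((n : ℝ) + 2) * r ^ (n + 1)) (fun n => norm_nonneg _)
    (fun n => negBinom_pos (by linarith) _) (fun n => by positivity) hc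
    (Y := 4 * β ^ 2 * r ^ 2 * (1 - r ^ 2) ^ (-(2 * β + 2))) (fun N => by
      refine le_trans (le_of_eq ?_) (sum_sq_mul_negBinom_le N hβ (sq_nonneg r) hr2)
      refine Finset.sum_congr rfl fun n _ => ?_
      rw [mul_pow, ← pow_mul, ← pow_mul, mul_comm (n + 1) 2])
  refine ⟨h.1, h.2.trans (le_of_eq ?_)⟩
  have h1 : (1 - r ^ 2) ^ (-(2 * β + 2)) = ((1 - r ^ 2) ^ (-(β + 1))) ^ 2 := by
    rw [sq ((1 - r ^ 2) ^ (-(β + 1))), ← Real.rpow_add (by linarith)]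
    congr 1; ring
  rw [h1, show δ ^ 2 * (4 * β ^ 2 * r ^ 2 * ((1 - r ^ 2) ^ (-(β + 1))) ^ 2) =
    (δ * (β * (1 - r ^ 2) ^ (-(β + 1)) * (2 * r))) ^ 2 by ring]
  apply Real.sqrt_sq
  have : 0 ≤ (1 - r ^ 2) ^ (-(β + 1)) := Real.rpow_nonneg (by linarith) _
  positivity

lemma hasDerivAt_rotated_series {β δ : ℝ} (hβ : 1 ≤ β) (hδ : 0 ≤ δ) {c : ℕ → ℂ}
    (hc : ∀ N, ∑ n ∈ Finset.range N, ‖c n‖ ^ 2 / negBinom β (n + 2) ≤ δ ^ 2)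
    {e : ℂ} (he : ‖e‖ = 1) {r : ℝ} (hr0 : 0 ≤ r) (hr1 : r < 1) :
    HasDerivAt (fun r : ℝ => ∑' n, c n * ((r : ℂ) * e) ^ (n + 2))
      (∑' n, c n * (((n : ℂ) + 2) * (r : ℂ) ^ (n + 1) * e ^ (n + 2))) r := by
  obtain ⟨R, hrR, hR1⟩ := exists_between hr1
  have hR0 : 0 < R := hr0.trans_lt hrR
  -- The symmetric interval makes `r = 0` an interior point; the derivative bound at `R` majorizes
  -- all terms on it.
  refine hasDerivAt_tsum_of_isPreconnected
    (norm_rotated_series_deriv_le hβ hδ hc hR0.le hR1).1 (t := Set.Ioo (-R) R) isOpen_Ioo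
    isPreconnected_Ioo (g := fun n (r : ℝ) => c n * ((r : ℂ) * e) ^ (n + 2))
    (g' := fun n (r : ℝ) => c n * (((n : ℂ) + 2) * (r : ℂ) ^ (n + 1) * e ^ (n + 2)))
    (fun n y _ => ?_) (fun n y hy => ?_) (y₀ := 0) ⟨by linarith, hR0⟩ ?_ ⟨by linarith, hrR⟩
  · have h := (((hasDerivAt_id y).ofReal_comp.mul_const e).pow (n + 2)).const_mul (c n)
    convert! h using 1
    simp only [id_eq, Complex.ofReal_one]
    push_cast
    rw [mul_pow]
    ring
  · simp only [norm_mul, norm_pow, he, one_pow, mul_one, Complex.norm_real]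
    rw [show ((n : ℂ) + 2) = ((n + 2 : ℕ) : ℂ) by push_cast; rfl, Complex.norm_natCast]
    push_cast
    gcongr
    exact abs_le.2 ⟨hy.1.le, hy.2.le⟩
  · simp

/-- Along a ray, twice the real part of a series with vanishing terms of order below two is
Lipschitz with respect to `(1 - r ^ 2) ^ (-β)`. -/
lemma abs_re_series_sub_le {β δ : ℝ} (hβ : 1 ≤ β) (hδ : 0 ≤ δ) {c : ℕ → ℂ}
    (hc : ∀ N, ∑ n ∈ Finset.range N, ‖c n‖ ^ 2 / negBinom β (n + 2) ≤ δ ^ 2)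
    {e : ℂ} (he : ‖e‖ = 1) {r R : ℝ} (hr0 : 0 ≤ r) (hrR : r ≤ R) (hR1 : R < 1) :
    |2 * (∑' n, c n * ((R : ℂ) * e) ^ (n + 2)).re - 2 * (∑' n, c n * ((r : ℂ) * e) ^ (n + 2)).re| ≤
      2 * δ * ((1 - R ^ 2) ^ (-β) - (1 - r ^ 2) ^ (-β)) := by
  set g : ℝ → ℝ := fun r => (∑' n, c n * ((r : ℂ) * e) ^ (n + 2)).re with hg
  set y : ℝ → ℝ := fun r => (1 - r ^ 2) ^ (-β) with hy
  set d : ℝ → ℂ := fun r => ∑' n, c n * (((n : ℂ) + 2) * (r : ℂ) ^ (n + 1) * e ^ (n + 2)) with hd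
  have hgd : ∀ x, 0 ≤ x → x < 1 → HasDerivAt g (d x).re x := fun x h0 h1 =>
    Complex.reCLM.hasFDerivAt.comp_hasDerivAt x (hasDerivAt_rotated_series hβ hδ hc he h0 h1)
  have hyd : ∀ x, 0 ≤ x → x < 1 → HasDerivAt y (β * (1 - x ^ 2) ^ (-(β + 1)) * (2 * x)) x :=
    fun x h0 h1 => hasDerivAt_one_sub_sq_rpow_neg β (by nlinarith)
  have hdb : ∀ x, 0 ≤ x → x < 1 → |(d x).re| ≤ δ * (β * (1 - x ^ 2) ^ (-(β + 1)) * (2 * x)) := by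
    intro x h0 h1
    obtain ⟨hs, hle⟩ := norm_rotated_series_deriv_le hβ hδ hc h0 h1
    have hn : ∀ n, ‖c n * (((n : ℂ) + 2) * (x : ℂ) ^ (n + 1) * e ^ (n + 2))‖ =
        ‖c n‖ * (((n : ℝ) + 2) * x ^ (n + 1)) := by
      intro n
      simp only [norm_mul, norm_pow, he, one_pow, mul_one, Complex.norm_real]
      rw [show ((n : ℂ) + 2) = ((n + 2 : ℕ) : ℂ) by push_cast; rfl, Complex.norm_natCast,
        Real.norm_of_nonneg h0]
      push_cast; rfl
    refine (Complex.abs_re_le_norm _).trans ((norm_tsum_le_tsum_norm ?_).trans ?_)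
    · simpa only [hn] using hs
    · simpa only [hn] using hle
  -- The derivative bound says that `δ y - g` and `δ y + g` both increase; together they give the
  -- two-sided Lipschitz estimate.
  have mono : ∀ σ : ℝ, |σ| = 1 → MonotoneOn (fun x => δ * y x - σ * g x) (Set.Ico 0 1) := by
    intro σ hσ
    have hder : ∀ x, 0 ≤ x → x < 1 → HasDerivAt (fun x => δ * y x - σ * g x)
        (δ * (β * (1 - x ^ 2) ^ (-(β + 1)) * (2 * x)) - σ * (d x).re) x := fun x h0 h1 =>
      ((hyd x h0 h1).const_mul δ).sub ((hgd x h0 h1).const_mul σ)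
    refine monotoneOn_of_deriv_nonneg (convex_Ico 0 1)
      (fun x hx => (hder x hx.1 hx.2).continuousAt.continuousWithinAt)
      (fun x hx => ?_) (fun x hx => ?_)
    · rw [interior_Ico] at hx
      exact (hder x hx.1.le hx.2).differentiableAt.differentiableWithinAt
    · rw [interior_Ico] at hx
      rw [(hder x hx.1.le hx.2).deriv]
      have h1 : σ * (d x).re ≤ |(d x).re| := by
        refine (le_abs_self _).trans ?_
        rw [abs_mul, hσ, one_mul]
      linarith [hdb x hx.1.le hx.2]
  have m1 := mono 1 (by simp) ⟨hr0, hrR.trans_lt hR1⟩ ⟨hr0.trans hrR, hR1⟩ hrR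
  have m2 := mono (-1) (by simp) ⟨hr0, hrR.trans_lt hR1⟩ ⟨hr0.trans hrR, hR1⟩ hrR
  simp only at m1 m2
  rw [abs_le]
  constructor <;> linarith

/-- A Fourier series with positive frequencies only has mean zero. -/
lemma integral_series_exp_eq_zero {c : ℕ → ℂ} (hc : Summable fun n => ‖c n‖) (k : ℕ) :
    ∫ θ in (-Real.pi)..Real.pi,
      ∑' n, c n * Complex.exp (θ * Complex.I) ^ (n + k + 1) = 0 := by
  have h1 : ∀ (n : ℕ), ∫ θ in (-Real.pi)..Real.pi,
      c n * Complex.exp (θ * Complex.I) ^ (n + k + 1) = 0 := by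
    intro n
    rw [intervalIntegral.integral_const_mul]
    have : ∀ θ : ℝ, Complex.exp (θ * Complex.I) ^ (n + k + 1) =
        Complex.exp ((((n + k + 1 : ℕ) : ℂ) * Complex.I) * θ) := by
      intro θ; rw [← Complex.exp_nat_mul]; congr 1; ring
    simp only [this]
    rw [integral_exp_mul_complex (by simp; norm_cast)]
    rw [div_eq_zero_iff.2, mul_zero]
    left
    rw [sub_eq_zero, Complex.exp_eq_exp_iff_exists_int]
    exact ⟨(n + k + 1 : ℕ), by push_cast; ring⟩
  have h2 := intervalIntegral.hasSum_integral_of_dominated_convergence (μ := volume)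
    (a := -Real.pi) (b := Real.pi)
    (F := fun n (θ : ℝ) => c n * Complex.exp (θ * Complex.I) ^ (n + k + 1))
    (f := fun θ => ∑' n, c n * Complex.exp (θ * Complex.I) ^ (n + k + 1))
    (fun n _ => ‖c n‖) (fun n => by fun_prop)
    (fun n => Filter.Eventually.of_forall fun θ _ => by simp [Complex.norm_exp_ofReal_mul_I])
    (Filter.Eventually.of_forall fun θ _ => hc) (by simp)
    (Filter.Eventually.of_forall fun θ _ => (Summable.of_norm (by
      simpa [Complex.norm_exp_ofReal_mul_I] using hc)).hasSum)
  simp only [h1] at h2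
  exact h2.unique hasSum_zero

/-! ### Hyperbolic area in polar coordinates. -/

lemma measurableSet_unitDisk : MeasurableSet unitDisk := Metric.isOpen_ball.measurableSet

lemma mem_unitDisk {z : ℂ} : z ∈ unitDisk ↔ ‖z‖ < 1 := by simp [unitDisk]

lemma hyperbolicMeasure_eq_setLIntegral {S : Set ℂ} (hS : S ⊆ unitDisk) :
    hyperbolicMeasure S = ∫⁻ z in S, ENNReal.ofReal (1 / (1 - ‖z‖ ^ 2) ^ 2) := by
  rw [hyperbolicMeasure, withDensity_apply', Measure.restrict_restrict' measurableSet_unitDisk,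
    Set.inter_eq_left.2 hS]

/-- The radial density has primitive `(1 - r²)⁻¹ / 2`, so area is affine in the variable `(1 -
r²)⁻¹`. -/
lemma setLIntegral_radial_le {W : ℝ} (hW : 1 ≤ W) :
    ∫⁻ r in {r : ℝ | 0 < r ∧ r < 1 ∧ (1 - r ^ 2)⁻¹ ≤ W},
      ENNReal.ofReal (r * (1 / (1 - r ^ 2) ^ 2)) ≤ ENNReal.ofReal ((W - 1) / 2) := by
  have hW0 : 0 < W := by linarith
  set R := √(1 - W⁻¹) with hR
  have hWi : W⁻¹ ≤ 1 := inv_le_one_of_one_le₀ hW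
  have hR2 : R ^ 2 = 1 - W⁻¹ := Real.sq_sqrt (by linarith)
  have hR0 : 0 ≤ R := Real.sqrt_nonneg _
  have hR1 : R ^ 2 < 1 := by have := inv_pos.2 hW0; linarith
  have hsub : {r : ℝ | 0 < r ∧ r < 1 ∧ (1 - r ^ 2)⁻¹ ≤ W} ⊆ Set.Ioc 0 R := by
    rintro r ⟨h0, h1, h2⟩
    refine ⟨h0, Real.le_sqrt_of_sq_le ?_⟩
    have h3 : 0 < 1 - r ^ 2 := by nlinarith
    have := inv_anti₀ (inv_pos.2 h3) h2
    rw [inv_inv] at this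
    linarith
  refine (lintegral_mono_set hsub).trans ?_
  have hlt : ∀ r ∈ Set.Icc 0 R, 0 < 1 - r ^ 2 := by
    intro r hr
    have : r ^ 2 ≤ R ^ 2 := by have := hr.1; have := hr.2; gcongr
    linarith
  have hcont : ContinuousOn (fun r : ℝ => r * (1 / (1 - r ^ 2) ^ 2)) (Set.Icc 0 R) := by
    refine continuousOn_id.mul (continuousOn_const.div (by fun_prop) fun r hr => ?_)
    have := hlt r hr; positivity
  rw [← ofReal_integral_eq_lintegral_ofReal
    (hcont.integrableOn_Icc.mono_set Set.Ioc_subset_Icc_self)]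
  · rw [← intervalIntegral.integral_of_le hR0,
      intervalIntegral.integral_eq_sub_of_hasDerivAt (f := fun r => (1 - r ^ 2)⁻¹ / 2)]
    · apply ENNReal.ofReal_le_ofReal
      rw [hR2]
      simp
      linarith
    · intro r hr
      rw [Set.uIcc_of_le hR0] at hr
      have h := hlt r hr
      have h2 : HasDerivAt (fun x : ℝ => 1 - x ^ 2) (-(2 * r)) r := by
        simpa using (hasDerivAt_pow 2 r).const_sub 1
      convert! (h2.inv h.ne').div_const 2 using 1
      field_simp
    · rw [intervalIntegrable_iff_integrableOn_Ioc_of_le hR0]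
      exact hcont.integrableOn_Icc.mono_set Set.Ioc_subset_Icc_self
  · filter_upwards [ae_restrict_mem measurableSet_Ioc] with r hr
    have := hr.1
    positivity

/-- The hyperbolic measure of a set lying inside a curve given in polar coordinates. -/
lemma hyperbolicMeasure_le_of_polar {S : Set ℂ} (hS : S ⊆ unitDisk) (hSm : MeasurableSet S)
    {W : ℝ → ℝ} (hW : ∀ θ, 1 ≤ W θ)
    (h : ∀ r θ : ℝ, 0 < r → r < 1 → (r : ℂ) * Complex.exp (θ * Complex.I) ∈ S →
      (1 - r ^ 2)⁻¹ ≤ W θ) :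
    hyperbolicMeasure S ≤ ∫⁻ θ in Set.Ioo (-Real.pi) Real.pi, ENNReal.ofReal ((W θ - 1) / 2) := by
  rw [hyperbolicMeasure_eq_setLIntegral hS, ← lintegral_indicator hSm,
    ← Complex.lintegral_comp_polarCoord_symm, polarCoord_target, Measure.volume_eq_prod,
    ← Measure.prod_restrict, ← lintegral_prod_swap]
  -- Only an upper bound is wanted, so the inequality half of Tonelli suffices and `W` need not be
  -- measurable.
  refine (lintegral_prod_le _).trans (lintegral_mono fun θ => ?_)
  refine le_trans ?_ (setLIntegral_radial_le (hW θ))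
  have hm : MeasurableSet {r : ℝ | 0 < r ∧ r < 1 ∧ (1 - r ^ 2)⁻¹ ≤ W θ} := by
    measurability
  rw [← lintegral_indicator hm, ← lintegral_indicator measurableSet_Ioi]
  refine lintegral_mono fun r => ?_
  by_cases hr : 0 < r
  swap
  · simp [hr]
  have hz : Complex.polarCoord.symm (r, θ) = (r : ℂ) * Complex.exp (θ * Complex.I) := by
    rw [Complex.polarCoord_symm_apply, Complex.exp_mul_I]
    simp
  have hn : ‖(r : ℂ) * Complex.exp (θ * Complex.I)‖ = r := by
    simp [Complex.norm_exp_ofReal_mul_I, abs_of_pos hr]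
  rw [Set.indicator_of_mem (Set.mem_Ioi.2 hr), Prod.swap_prod_mk, hz]
  by_cases hzS : (r : ℂ) * Complex.exp (θ * Complex.I) ∈ S
  · have hr1 : r < 1 := by simpa only [hn] using mem_unitDisk.1 (hS hzS)
    have hmem : r ∈ {r : ℝ | 0 < r ∧ r < 1 ∧ (1 - r ^ 2)⁻¹ ≤ W θ} :=
      ⟨hr, hr1, h r θ hr hr1 hzS⟩
    rw [Set.indicator_of_mem hzS, Set.indicator_of_mem hmem,
      smul_eq_mul, ENNReal.ofReal_mul hr.le, hn]
  · rw [Set.indicator_of_notMem hzS, smul_zero]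
    exact zero_le

/-! ### Superlevel sets of a perturbed radial profile. -/

/-- A crude first pass gives `y - 1 ≤ 2 (1 - s) / s`. If `|y - 1/s| ≤ 6 δ (1 - s) / s²`, replacing
`h` by `h₀` costs `2δ · 6δ` and the quadratic term costs `2δ²`, each times `(1 - s) / s²`: this is
the constant `14`. A larger `y` contradicts the crude bound, and for a smaller `y` the claim follows
from the lower bound on `h₀`. -/
lemma level_bound_of_perturbation {s δ y h h₀ : ℝ} (hs0 : 0 < s) (hs1 : s ≤ 1) (hδ : 0 ≤ δ)
    (hδs : 6 * δ ≤ s) (hy : 1 ≤ y) (hh : |h| ≤ 2 * δ * (y - 1))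
    (hh₀ : |h₀| ≤ 2 * δ * (1 / s - 1)) (hd : |h - h₀| ≤ 2 * δ * |y - 1 / s|)
    (hlev : s * y < 1 + h + δ ^ 2 * (y - 1)) :
    s * y ≤ 1 + (h₀ + 14 * δ ^ 2 / s ^ 2 * (1 - s)) := by
  have hδ2 : δ ^ 2 ≤ δ := by nlinarith
  have h1 := (abs_le.1 hh).2
  have e1 : s * y < 1 + 3 * δ * (y - 1) := by nlinarith
  have e2 : s * (y - 1) ≤ 2 * (1 - s) := by nlinarith
  have e3 : y - 1 ≤ 2 * (1 - s) / s := by rw [le_div_iff₀ hs0]; linarith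
  have hq : 0 ≤ (1 - s) / s := div_nonneg (by linarith) hs0.le
  have e4 : (1 - s) / s ≤ (1 - s) / s ^ 2 := by
    apply div_le_div_of_nonneg_left (by linarith) (by positivity)
    nlinarith
  have ey : s * (1 / s) = 1 := by field_simp
  have es : s * ((1 - s) / s ^ 2) = (1 - s) / s := by field_simp
  have e5 : 1 / s - 1 = (1 - s) / s := by field_simp
  have e6 : 2 * (1 - s) / s = 2 * ((1 - s) / s) := by ring
  have e7 : 14 * δ ^ 2 / s ^ 2 * (1 - s) = 14 * δ ^ 2 * ((1 - s) / s ^ 2) := by ring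
  rw [e5] at hh₀
  rw [e6] at e3
  rw [e7]
  have hh₀' := (abs_le.1 hh₀).1
  have hp : 0 ≤ δ ^ 2 * ((1 - s) / s ^ 2) := by
    have : 0 ≤ (1 - s) / s ^ 2 := hq.trans e4
    positivity
  by_cases hc : |y - 1 / s| ≤ 6 * δ * ((1 - s) / s ^ 2)
  · have h2 := (abs_le.1 hd).2
    have h3 : 2 * δ * |y - 1 / s| ≤ 2 * δ * (6 * δ * ((1 - s) / s ^ 2)) := by gcongr
    have h4 : δ ^ 2 * (y - 1) ≤ δ ^ 2 * (2 * ((1 - s) / s ^ 2)) := by gcongr; linarith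
    nlinarith
  · push Not at hc
    rcases lt_abs.1 hc with h2 | h2
    · exfalso
      have h3 := mul_lt_mul_of_pos_left h2 hs0
      have h4 : 3 * δ * (y - 1) ≤ 3 * δ * (2 * ((1 - s) / s)) := by gcongr
      have h5 : s * (6 * δ * ((1 - s) / s ^ 2)) = 6 * δ * ((1 - s) / s) := by
        rw [← es]; ring
      nlinarith
    · have h3 := mul_lt_mul_of_pos_left h2 hs0
      have h5 : s * (6 * δ * ((1 - s) / s ^ 2)) = 6 * δ * ((1 - s) / s) := by
        rw [← es]; ring
      have h6 : 0 ≤ δ * ((1 - s) / s) := by positivity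
      nlinarith

lemma integral_re_series_eq_zero {c : ℕ → ℂ} {r : ℝ} (hr : 0 ≤ r)
    (hc : Summable fun n => ‖c n‖ * r ^ (n + 2)) :
    Continuous (fun θ : ℝ =>
      2 * (∑' n, c n * ((r : ℂ) * Complex.exp (θ * Complex.I)) ^ (n + 2)).re) ∧
    ∫ θ in (-Real.pi)..Real.pi,
      2 * (∑' n, c n * ((r : ℂ) * Complex.exp (θ * Complex.I)) ^ (n + 2)).re = 0 := by
  have hn : ∀ n, ‖c n * (r : ℂ) ^ (n + 2)‖ = ‖c n‖ * r ^ (n + 2) := by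
    intro n; simp [abs_of_nonneg hr]
  have hc' : Summable fun n => ‖c n * (r : ℂ) ^ (n + 2)‖ := by simpa only [hn] using hc
  have he : ∀ θ : ℝ, ∑' n, c n * ((r : ℂ) * Complex.exp (θ * Complex.I)) ^ (n + 2) =
      ∑' n, (c n * (r : ℂ) ^ (n + 2)) * Complex.exp (θ * Complex.I) ^ (n + 1 + 1) := by
    intro θ; congr 1; ext n; rw [mul_pow]; ring
  have hcont : Continuous (fun θ : ℝ =>
      ∑' n, (c n * (r : ℂ) ^ (n + 2)) * Complex.exp (θ * Complex.I) ^ (n + 1 + 1)) := by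
    refine continuous_tsum (fun n => by fun_prop) hc' fun n θ => ?_
    simp [Complex.norm_exp_ofReal_mul_I]
  simp only [he]
  refine ⟨continuous_const.mul (Complex.continuous_re.comp hcont), ?_⟩
  rw [intervalIntegral.integral_const_mul]
  have := Complex.reCLM.intervalIntegral_comp_comm (μ := volume)
    (hcont.intervalIntegrable (-Real.pi) Real.pi)
  simp only [Complex.reCLM_apply] at this
  rw [this, integral_series_exp_eq_zero hc' 1]
  simp

/-- Hyperbolic area of a superlevel set of a perturbation of `(1 - |z|²)^β`: the harmonic first
order part of the perturbation does not contribute to first order. -/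
theorem hyperbolicMeasure_perturbed_level_le {β δ s : ℝ} (hβ : 1 ≤ β) (hδ : 0 ≤ δ) (hs0 : 0 < s)
    (hs1 : s < 1) (hδs : 6 * δ ≤ s) {c : ℕ → ℂ}
    (hc : ∀ N, ∑ n ∈ Finset.range N, ‖c n‖ ^ 2 / negBinom β (n + 2) ≤ δ ^ 2)
    {S : Set ℂ} (hS : S ⊆ unitDisk) (hSm : MeasurableSet S)
    (hlev : ∀ z ∈ S, s * (1 - ‖z‖ ^ 2) ^ (-β) < 1 + 2 * (∑' n, c n * z ^ (n + 2)).re +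
      δ ^ 2 * ((1 - ‖z‖ ^ 2) ^ (-β) - 1)) :
    hyperbolicMeasure S ≤ ENNReal.ofReal (Real.pi * (1 + 14 * δ ^ 2 / s ^ 2) *
      ((1 / s) ^ (1 / β) - 1)) := by
  have hβ0 : 0 < β := by linarith
  have hsβ0 : 0 < s ^ (1 / β) := Real.rpow_pos_of_pos hs0 _
  have hsβ1 : s ^ (1 / β) < 1 := Real.rpow_lt_one hs0.le hs1 (by positivity)
  -- The radius of the unperturbed level circle, where `(1 - r²)^(-β) = 1/s`.
  set r₀ := √(1 - s ^ (1 / β)) with hr₀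
  have hr₀2 : r₀ ^ 2 = 1 - s ^ (1 / β) := Real.sq_sqrt (by linarith)
  have hr₀0 : 0 ≤ r₀ := Real.sqrt_nonneg _
  have hr₀1 : r₀ < 1 := by nlinarith
  have hy₀ : (1 - r₀ ^ 2) ^ (-β) = 1 / s := by
    rw [hr₀2, sub_sub_cancel, ← Real.rpow_mul hs0.le, mul_neg, one_div_mul_cancel hβ0.ne',
      Real.rpow_neg_one, one_div]
  set H : ℝ → ℝ → ℝ := fun r θ =>
    2 * (∑' n, c n * ((r : ℂ) * Complex.exp (θ * Complex.I)) ^ (n + 2)).re with hH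
  have hLip : ∀ r R θ : ℝ, 0 ≤ r → r ≤ R → R < 1 → |H R θ - H r θ| ≤
      2 * δ * ((1 - R ^ 2) ^ (-β) - (1 - r ^ 2) ^ (-β)) := fun r R θ h0 h1 h2 =>
    abs_re_series_sub_le hβ hδ hc (Complex.norm_exp_ofReal_mul_I θ) h0 h1 h2
  have hzero : ∀ θ, H 0 θ = 0 := by intro θ; simp [hH]
  have hH0 : ∀ R θ : ℝ, 0 ≤ R → R < 1 → |H R θ| ≤ 2 * δ * ((1 - R ^ 2) ^ (-β) - 1) := by
    intro R θ h0 h1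
    have := hLip 0 R θ le_rfl h0 h1
    simpa [hzero] using this
  set K := 14 * δ ^ 2 / s ^ 2 with hK
  have hK0 : 0 ≤ K := by positivity
  -- This lower bound gives both the hypothesis of Bernoulli's inequality and `1 ≤ W θ`.
  have hx : ∀ θ, s ≤ 1 + (H r₀ θ + K * (1 - s)) := by
    intro θ
    have h1 := (abs_le.1 (hH0 r₀ θ hr₀0 hr₀1)).1
    rw [hy₀] at h1
    have h2 : 2 * δ * (1 / s - 1) ≤ 1 - s := by
      rw [show 2 * δ * (1 / s - 1) = 2 * δ * (1 - s) / s by field_simp, div_le_iff₀ hs0]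
      nlinarith
    have h3 : 0 ≤ K * (1 - s) := mul_nonneg hK0 (by linarith)
    linarith
  set W : ℝ → ℝ := fun θ => (1 / s) ^ (1 / β) * (1 + 1 / β * (H r₀ θ + K * (1 - s))) with hWdef
  have hβi0 : 0 ≤ 1 / β := by positivity
  have hβi1 : 1 / β ≤ 1 := by rw [div_le_one hβ0]; exact hβ
  -- Since `1/β ≤ 1`, Bernoulli's inequality replaces the power by an expression linear in `H r₀ θ`,
  -- whose mean over the circle vanishes.
  have hMW : ∀ θ, (1 / s * (1 + (H r₀ θ + K * (1 - s)))) ^ (1 / β) ≤ W θ := by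
    intro θ
    have := hx θ
    rw [Real.mul_rpow (by positivity) (by linarith)]
    exact mul_le_mul_of_nonneg_left
      (rpow_one_add_le_one_add_mul_self (by linarith) hβi0 hβi1) (by positivity)
  have hW1 : ∀ θ, 1 ≤ W θ := by
    intro θ
    refine le_trans (Real.one_le_rpow ?_ hβi0) (hMW θ)
    have := hx θ
    rw [one_div, ← div_eq_inv_mul, le_div_iff₀ hs0]
    linarith
  refine (hyperbolicMeasure_le_of_polar hS hSm hW1 ?_).trans ?_
  · intro r θ hr0 hr1 hrS
    refine le_trans ?_ (hMW θ)
    have hl := hlev _ hrS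
    have hn : ‖(r : ℂ) * Complex.exp (θ * Complex.I)‖ = r := by
      simp [Complex.norm_exp_ofReal_mul_I, abs_of_pos hr0]
    rw [hn] at hl
    have hr2 : 0 < 1 - r ^ 2 := by nlinarith
    set y := (1 - r ^ 2) ^ (-β) with hy
    have hy1 : 1 ≤ y := Real.one_le_rpow_of_pos_of_le_one_of_nonpos hr2 (by nlinarith) (by linarith)
    have hd : |H r θ - H r₀ θ| ≤ 2 * δ * |y - 1 / s| := by
      rcases le_total r r₀ with h | h
      · have := hLip r r₀ θ hr0.le h hr₀1
        rw [hy₀, abs_sub_comm] at this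
        refine this.trans ?_
        rw [abs_sub_comm y]
        gcongr
        exact le_abs_self _
      · have := hLip r₀ r θ hr₀0 h hr1
        rw [hy₀] at this
        refine this.trans ?_
        gcongr
        exact le_abs_self _
    have hb := level_bound_of_perturbation hs0 hs1.le hδ hδs hy1 (hH0 r θ hr0.le hr1)
      (by simpa only [hy₀] using hH0 r₀ θ hr₀0 hr₀1) hd hl
    have hyr : (1 - r ^ 2)⁻¹ = y ^ (1 / β) := by
      rw [hy, ← Real.rpow_mul hr2.le, neg_mul, mul_one_div_cancel hβ0.ne', Real.rpow_neg_one]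
    rw [hyr]
    refine Real.rpow_le_rpow (by linarith) ?_ hβi0
    rw [one_div, ← div_eq_inv_mul, le_div_iff₀ hs0]
    linarith
  · have hsum : Summable fun n => ‖c n‖ * r₀ ^ (n + 2) := by
      refine Summable.of_nonneg_of_le (fun n => by positivity) (fun n => ?_)
        (norm_rotated_series_deriv_le hβ hδ hc hr₀0 hr₀1).1
      rw [pow_succ' r₀ (n + 1)]
      have hn : (0 : ℝ) ≤ n := n.cast_nonneg
      gcongr
      linarith
    obtain ⟨hcont, hint⟩ := integral_re_series_eq_zero hr₀0 hsum
    have hcont' : Continuous (H r₀) := hcont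
    have hWc : Continuous fun θ => (W θ - 1) / 2 := by
      simp only [hWdef]; fun_prop
    rw [Measure.restrict_congr_set Ioo_ae_eq_Ioc, ← ofReal_integral_eq_lintegral_ofReal
      (hWc.integrableOn_Ioc) (Filter.Eventually.of_forall fun θ => by
        have := hW1 θ; simp only [Pi.zero_apply]; linarith),
      ← intervalIntegral.integral_of_le (by linarith [Real.pi_pos])]
    apply ENNReal.ofReal_le_ofReal
    have hWe : ∀ θ, (W θ - 1) / 2 = (1 / s) ^ (1 / β) / (2 * β) * H r₀ θ +
        ((1 / s) ^ (1 / β) * (1 + K * (1 - s) / β) - 1) / 2 := by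
      intro θ; simp only [hWdef]; field_simp; ring
    simp only [hWe]
    rw [intervalIntegral.integral_add ((hcont'.const_mul _).intervalIntegrable _ _)
      (by simp), intervalIntegral.integral_const_mul]
    have hint' : ∫ θ in (-Real.pi)..Real.pi, H r₀ θ = 0 := hint
    rw [hint', intervalIntegral.integral_const, smul_eq_mul, mul_zero, zero_add]
    -- Bernoulli again: the error `K (1 - s) / β` is absorbed into `K` times the unperturbed area,
    -- with no loss in `β`.
    have hB : (1 - s) / β ≤ 1 - s ^ (1 / β) := by
      have := rpow_one_add_le_one_add_mul_self (s := s - 1) (by linarith) hβi0 hβi1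
      rw [add_sub_cancel] at this
      have e : 1 / β * (s - 1) = -((1 - s) / β) := by ring
      linarith
    have hY : (1 / s) ^ (1 / β) * s ^ (1 / β) = 1 := by
      rw [← Real.mul_rpow (by positivity) hs0.le, one_div_mul_cancel hs0.ne', Real.one_rpow]
    have hY0 : 0 ≤ (1 / s) ^ (1 / β) := by positivity
    have h1 := mul_le_mul_of_nonneg_left hB (mul_nonneg hK0 hY0)
    have h2 : (1 / s) ^ (1 / β) * (1 + K * (1 - s) / β) - 1 ≤
        (1 + K) * ((1 / s) ^ (1 / β) - 1) := by
      have e : K * (1 / s) ^ (1 / β) * (1 - s ^ (1 / β)) = K * ((1 / s) ^ (1 / β) - 1) := by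
        rw [mul_sub, mul_assoc K _ (s ^ (1 / β)), hY]; ring
      rw [e] at h1
      have e2 : (1 / s) ^ (1 / β) * (1 + K * (1 - s) / β) - 1 = (1 / s) ^ (1 / β) - 1 +
        K * (1 / s) ^ (1 / β) * ((1 - s) / β) := by ring
      rw [e2]; linarith
    nlinarith [Real.pi_pos]

/-! ### Hilbert space valued power series with density maximal at the origin. -/

section

variable {E : Type*} [NormedAddCommGroup E]

lemma summable_norm_mul_pow {β : ℝ} (hβ : 0 < β) {A : ℕ → E} {X : ℝ}
    (hA : ∀ N, ∑ n ∈ Finset.range N, ‖A n‖ ^ 2 / negBinom β n ≤ X) {r : ℝ} (hr0 : 0 ≤ r)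
    (hr1 : r < 1) : Summable fun n => ‖A n‖ * r ^ n :=
  (summable_and_tsum_mul_le (fun n => norm_nonneg _) (fun n => negBinom_pos hβ n)
    (fun n => pow_nonneg hr0 n) hA (Y := (1 - r ^ 2) ^ (-β)) (fun N => by
      refine le_trans (le_of_eq (Finset.sum_congr rfl fun n _ => ?_))
        (sum_negBinom_mul_pow_le N hβ (sq_nonneg r) (by nlinarith))
      rw [← pow_mul, ← pow_mul, mul_comm n 2])).1

variable [InnerProductSpace ℂ E]

lemma summable_pow_smul [CompleteSpace E] {A : ℕ → E} (hA : ∀ r : ℝ, 0 ≤ r → r < 1 → Summable fun n => ‖A n‖ * r ^ n)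
    {z : ℂ} (hz : ‖z‖ < 1) : Summable fun n => z ^ n • A n := by
  refine Summable.of_norm ?_
  simpa [norm_smul, mul_comm] using hA ‖z‖ (norm_nonneg z) hz

lemma continuousOn_pow_smul_series [CompleteSpace E] {A : ℕ → E}
    (hA : ∀ r : ℝ, 0 ≤ r → r < 1 → Summable fun n => ‖A n‖ * r ^ n) :
    ContinuousOn (fun z : ℂ => ∑' n, z ^ n • A n) unitDisk := by
  intro z hz
  obtain ⟨R, hzR, hR1⟩ := exists_between (mem_unitDisk.1 hz)
  have hR0 : 0 ≤ R := (norm_nonneg z).trans hzR.le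
  have : ContinuousOn (fun z : ℂ => ∑' n, z ^ n • A n) (Metric.ball 0 R) := by
    refine continuousOn_tsum (fun n => by fun_prop) (hA R hR0 hR1) fun n w hw => ?_
    rw [norm_smul, norm_pow, mul_comm]
    have : ‖w‖ < R := by simpa using hw
    gcongr
  exact (this.continuousAt (Metric.isOpen_ball.mem_nhds (by simpa using hzR))).continuousWithinAt

lemma measurableSet_series_level [CompleteSpace E] {A : ℕ → E}
    (hA : ∀ r : ℝ, 0 ≤ r → r < 1 → Summable fun n => ‖A n‖ * r ^ n) (β t : ℝ) :
    MeasurableSet {z | z ∈ unitDisk ∧ t < ‖∑' n, z ^ n • A n‖ ^ 2 * (1 - ‖z‖ ^ 2) ^ β} := by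
  have hcont : ContinuousOn (fun z : ℂ => ‖∑' n, z ^ n • A n‖ ^ 2 * (1 - ‖z‖ ^ 2) ^ β)
      unitDisk := by
    refine ((continuousOn_pow_smul_series hA).norm.pow 2).mul ?_
    refine ContinuousOn.rpow_const (by fun_prop) fun z hz => Or.inl ?_
    have := mem_unitDisk.1 hz
    nlinarith [norm_nonneg z]
  exact (hcont.isOpen_inter_preimage Metric.isOpen_ball isOpen_Ioi).measurableSet

/-- Reproducing kernel bound for a series without constant term. -/
lemma norm_series_succ_sq_le {β : ℝ} (hβ : 0 < β) {A : ℕ → E} {X : ℝ}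
    (hA : ∀ N, ∑ n ∈ Finset.range N, ‖A (n + 1)‖ ^ 2 / negBinom β (n + 1) ≤ X) {z : ℂ}
    (hz : ‖z‖ < 1) :
    ‖∑' n, z ^ (n + 1) • A (n + 1)‖ ^ 2 ≤ X * ((1 - ‖z‖ ^ 2) ^ (-β) - 1) := by
  have hz2 : ‖z‖ ^ 2 < 1 := by nlinarith [norm_nonneg z]
  have h := summable_and_tsum_mul_le (fun n => norm_nonneg (A (n + 1)))
    (fun n => negBinom_pos hβ (n + 1)) (m := fun n => ‖z‖ ^ (n + 1)) (fun n => by positivity) hA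
    (Y := (1 - ‖z‖ ^ 2) ^ (-β) - 1) (fun N => by
      refine le_trans (le_of_eq (Finset.sum_congr rfl fun n _ => ?_))
        (sum_negBinom_succ_mul_pow_le N hβ (sq_nonneg _) hz2)
      rw [← pow_mul, ← pow_mul, mul_comm (n + 1) 2])
  have hn : ∀ n, ‖z ^ (n + 1) • A (n + 1)‖ = ‖A (n + 1)‖ * ‖z‖ ^ (n + 1) := by
    intro n; rw [norm_smul, norm_pow, mul_comm]
  have h1 : ‖∑' n, z ^ (n + 1) • A (n + 1)‖ ≤ √(X * ((1 - ‖z‖ ^ 2) ^ (-β) - 1)) := by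
    refine (norm_tsum_le_tsum_norm ?_).trans ?_
    · simpa only [hn] using h.1
    · simpa only [hn] using h.2
  have hX : 0 ≤ X := by simpa using hA 0
  have hY : 0 ≤ (1 - ‖z‖ ^ 2) ^ (-β) - 1 := by
    simpa using sum_negBinom_succ_mul_pow_le 0 hβ (sq_nonneg ‖z‖) hz2
  rw [← Real.sq_sqrt (mul_nonneg hX hY)]
  gcongr

lemma rpow_neg_sub_one_le {β x : ℝ} (hβ : 1 ≤ β) (hx0 : 0 ≤ x) (hx1 : x < 1)
    (hx : β * x ≤ 1 / 2) : (1 - x) ^ (-β) - 1 ≤ 2 * β * x := by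
  have h1 := one_add_mul_self_le_rpow_one_add (s := -x) (by linarith) hβ
  rw [← sub_eq_add_neg] at h1
  have h2 : 0 ≤ β * x := by positivity
  have h3 : 1 / 2 ≤ (1 - x) ^ β := by linarith
  rw [Real.rpow_neg (by linarith), sub_le_iff_le_add, inv_le_iff_one_le_mul₀ (by linarith)]
  nlinarith

/-- The first order coefficient vanishes at a maximum. -/
lemma inner_eq_zero_of_max {β : ℝ} (hβ : 1 ≤ β) {A : ℕ → E}
    (hA : ∀ r : ℝ, 0 ≤ r → r < 1 → Summable fun n => ‖A n‖ * r ^ n)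
    (hmax : ∀ z ∈ unitDisk, 2 * (∑' n, inner ℂ (A 0) (A (n + 1)) * z ^ (n + 1)).re ≤
      ‖A 0‖ ^ 2 * ((1 - ‖z‖ ^ 2) ^ (-β) - 1)) : inner ℂ (A 0) (A 1) = (0 : ℂ) := by
  set κ : ℂ := inner ℂ (A 0) (A 1) with hκ
  set B := ∑' n, ‖A 0‖ * ‖A (n + 2)‖ * (1 / 2) ^ n with hB
  have hsumB : Summable fun n => ‖A 0‖ * ‖A (n + 2)‖ * (1 / 2 : ℝ) ^ n := by
    have h := ((summable_nat_add_iff 2).2 (hA (1 / 2) (by norm_num) (by norm_num))).mul_left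
      (4 * ‖A 0‖)
    refine h.congr fun n => ?_
    rw [pow_add]; ring
  have hsum : ∀ z : ℂ, ‖z‖ ≤ 1 / 2 →
      Summable fun n => (inner ℂ (A 0) (A (n + 1)) : ℂ) * z ^ (n + 1) := by
    intro z hz
    have h := ((summable_nat_add_iff 1).2 (hA (1 / 2) (by norm_num) (by norm_num))).mul_left ‖A 0‖
    refine Summable.of_norm_bounded h fun n => ?_
    rw [norm_mul, norm_pow, ← mul_assoc]
    gcongr
    exact norm_inner_le_norm _ _
  have htail : ∀ z : ℂ, ‖z‖ ≤ 1 / 2 →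
      ‖∑' n, (inner ℂ (A 0) (A (n + 2)) : ℂ) * z ^ (n + 2)‖ ≤ ‖z‖ ^ 2 * B := by
    intro z hz
    rw [hB, ← tsum_mul_left]
    refine tsum_of_norm_bounded (hsumB.mul_left _).hasSum fun n => ?_
    rw [norm_mul, norm_pow, pow_add, mul_comm (‖z‖ ^ n), mul_left_comm]
    gcongr
    exact norm_inner_le_norm _ _
  have hε : ∀ᶠ ε : ℝ in nhdsWithin 0 (Set.Ioi 0), 2 * ‖κ‖ ^ 2 ≤
      ε * (‖A 0‖ ^ 2 * (2 * β * ‖κ‖ ^ 2) + 2 * (‖κ‖ ^ 2 * B)) := by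
    have h1 : ∀ᶠ ε : ℝ in nhdsWithin 0 (Set.Ioi 0), ε * ‖κ‖ < 1 / 2 :=
      (((continuous_id.mul continuous_const).tendsto' 0 0 (by simp)).mono_left
        nhdsWithin_le_nhds).eventually_lt_const (by norm_num)
    have h2 : ∀ᶠ ε : ℝ in nhdsWithin 0 (Set.Ioi 0), β * (ε * ‖κ‖) ^ 2 < 1 / 2 :=
      ((Continuous.tendsto' (by fun_prop) 0 0 (by simp)).mono_left
        nhdsWithin_le_nhds).eventually_lt_const (by norm_num)
    filter_upwards [h1, h2, self_mem_nhdsWithin] with ε h1 h2 h3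
    have h3 : 0 < ε := h3
    -- In this direction the linear term equals `ε ‖κ‖²`, while every other term is `O(ε²)`; letting
    -- `ε → 0` forces `κ = 0`.
    set z : ℂ := ε * (starRingEnd ℂ) κ with hz
    have hzn : ‖z‖ = ε * ‖κ‖ := by simp [hz, abs_of_pos h3]
    have hz1 : ‖z‖ ≤ 1 / 2 := by rw [hzn]; exact h1.le
    have hm := hmax z (mem_unitDisk.2 (by linarith))
    rw [(hsum z hz1).tsum_eq_zero_add] at hm
    have hk : κ * z = ((ε * ‖κ‖ ^ 2 : ℝ) : ℂ) := by
      rw [hz, mul_left_comm, Complex.mul_conj, Complex.normSq_eq_norm_sq]; push_cast; rfl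
    have ht := (abs_le.1 ((Complex.abs_re_le_norm _).trans (htail z hz1))).1
    simp only [zero_add, pow_one, ← hκ, hk, Complex.add_re, Complex.ofReal_re] at hm
    have hy := rpow_neg_sub_one_le hβ (sq_nonneg ‖z‖) (by nlinarith [norm_nonneg z])
      (by rw [hzn]; exact h2.le)
    have hy' := mul_le_mul_of_nonneg_left hy (sq_nonneg ‖A 0‖)
    rw [hzn] at ht hy' hm
    have : ε * (2 * ‖κ‖ ^ 2) ≤
        ε * (ε * (‖A 0‖ ^ 2 * (2 * β * ‖κ‖ ^ 2) + 2 * (‖κ‖ ^ 2 * B))) := by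
      have e : ∑' n, (inner ℂ (A 0) (A (n + 1 + 1)) : ℂ) * z ^ (n + 1 + 1) =
        ∑' n, (inner ℂ (A 0) (A (n + 2)) : ℂ) * z ^ (n + 2) := rfl
      rw [e] at hm
      nlinarith
    exact le_of_mul_le_mul_left this h3
  have hlim : Filter.Tendsto
      (fun ε : ℝ => ε * (‖A 0‖ ^ 2 * (2 * β * ‖κ‖ ^ 2) + 2 * (‖κ‖ ^ 2 * B)))
      (nhdsWithin 0 (Set.Ioi 0)) (nhds 0) :=
    ((continuous_id.mul continuous_const).tendsto' 0 0 (by simp)).mono_left nhdsWithin_le_nhds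
  have := ge_of_tendsto hlim hε
  have h0 : ‖κ‖ ^ 2 = 0 := le_antisymm (by linarith) (sq_nonneg _)
  simpa using h0

/-- The area estimate for a Hilbert space valued power series whose density is maximal at `0`. -/
theorem hyperbolicMeasure_series_level_le [CompleteSpace E] {β t T : ℝ} (hβ : 1 ≤ β) {A : ℕ → E}
    (hA : ∀ N, ∑ n ∈ Finset.range N, ‖A n‖ ^ 2 / negBinom β n ≤ 1) (hT : ‖A 0‖ ^ 2 = T)
    (hmax : ∀ z ∈ unitDisk, ‖∑' n, z ^ n • A n‖ ^ 2 * (1 - ‖z‖ ^ 2) ^ β ≤ T)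
    (ht0 : 0 < t) (htT : t < T) (hδ : 36 * ((1 - T) / T) ≤ (t / T) ^ 2) :
    hyperbolicMeasure {z | z ∈ unitDisk ∧ t < ‖∑' n, z ^ n • A n‖ ^ 2 * (1 - ‖z‖ ^ 2) ^ β} ≤
      ENNReal.ofReal (Real.pi * (1 + 14 * ((1 - T) / T) / (t / T) ^ 2) *
        ((T / t) ^ (1 / β) - 1)) := by
  have hT0 : 0 < T := ht0.trans htT
  have hβ0 : 0 < β := by linarith
  have hT1 : T ≤ 1 := by simpa [negBinom_zero, hT] using hA 1
  have hAs : ∀ r : ℝ, 0 ≤ r → r < 1 → Summable fun n => ‖A n‖ * r ^ n := fun r h0 h1 =>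
    summable_norm_mul_pow hβ0 hA h0 h1
  have hA1 : ∀ N, ∑ n ∈ Finset.range N, ‖A (n + 1)‖ ^ 2 / negBinom β (n + 1) ≤ 1 - T := by
    intro N
    have := hA (N + 1)
    rw [Finset.sum_range_succ', negBinom_zero, hT] at this
    linarith
  have hfull : ∀ z ∈ unitDisk, ∑' n, z ^ n • A n = A 0 + ∑' n, z ^ (n + 1) • A (n + 1) := by
    intro z hz
    rw [(summable_pow_smul hAs (mem_unitDisk.1 hz)).tsum_eq_zero_add]
    simp
  have hinner : ∀ z ∈ unitDisk, inner ℂ (A 0) (∑' n, z ^ (n + 1) • A (n + 1)) =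
      ∑' n, (inner ℂ (A 0) (A (n + 1)) : ℂ) * z ^ (n + 1) := by
    intro z hz
    have h := (innerSL ℂ (A 0)).map_tsum
      ((summable_nat_add_iff 1).2 (summable_pow_smul hAs (mem_unitDisk.1 hz)))
    simpa [inner_smul_right, mul_comm] using h
  have hy0 : ∀ z ∈ unitDisk, 0 < 1 - ‖z‖ ^ 2 := by
    intro z hz
    have := mem_unitDisk.1 hz
    nlinarith [norm_nonneg z]
  have hexp : ∀ z ∈ unitDisk, ‖∑' n, z ^ n • A n‖ ^ 2 = T +
      2 * (∑' n, (inner ℂ (A 0) (A (n + 1)) : ℂ) * z ^ (n + 1)).re +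
      ‖∑' n, z ^ (n + 1) • A (n + 1)‖ ^ 2 := by
    intro z hz
    rw [hfull z hz, @norm_add_sq ℂ, hinner z hz, hT]
    rfl
  have hyy : ∀ z ∈ unitDisk, (1 - ‖z‖ ^ 2) ^ β * (1 - ‖z‖ ^ 2) ^ (-β) = 1 := by
    intro z hz
    rw [← Real.rpow_add (hy0 z hz)]; simp
  have hk : inner ℂ (A 0) (A 1) = (0 : ℂ) := by
    refine inner_eq_zero_of_max hβ hAs fun z hz => ?_
    have h1 := mul_le_mul_of_nonneg_right (hmax z hz)
      (Real.rpow_nonneg (hy0 z hz).le (-β))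
    rw [mul_assoc, hyy z hz, mul_one, hexp z hz] at h1
    rw [hT]
    nlinarith [sq_nonneg ‖∑' n, z ^ (n + 1) • A (n + 1)‖]
  -- Dividing by `T` normalizes the constant term to `1`. Cauchy–Schwarz in `E` costs a factor `T`,
  -- which leaves `δ² = (1 - T) / T` for the weighted sum of `‖c n‖²`.
  set c : ℕ → ℂ := fun n => inner ℂ (A 0) (A (n + 2)) / T with hc
  have hser : ∀ z ∈ unitDisk, ∑' n, (inner ℂ (A 0) (A (n + 1)) : ℂ) * z ^ (n + 1) =
      T * ∑' n, c n * z ^ (n + 2) := by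
    intro z hz
    have hs : Summable fun n => (inner ℂ (A 0) (A (n + 1)) : ℂ) * z ^ (n + 1) := by
      have h := (innerSL ℂ (A 0)).summable
        ((summable_nat_add_iff 1).2 (summable_pow_smul hAs (mem_unitDisk.1 hz)))
      simpa [inner_smul_right, mul_comm] using h
    rw [hs.tsum_eq_zero_add, zero_add, hk, zero_mul, zero_add, ← tsum_mul_left]
    refine tsum_congr fun n => ?_
    have : (T : ℂ) ≠ 0 := by exact_mod_cast hT0.ne'
    simp only [hc]
    field_simp
  have hδ0 : 0 ≤ (1 - T) / T := div_nonneg (by linarith) hT0.le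
  have hs0 : 0 < t / T := by positivity
  have hcb : ∀ N, ∑ n ∈ Finset.range N, ‖c n‖ ^ 2 / negBinom β (n + 2) ≤ √((1 - T) / T) ^ 2 := by
    intro N
    rw [Real.sq_sqrt hδ0]
    have h2 : ∑ n ∈ Finset.range N, ‖A (n + 2)‖ ^ 2 / negBinom β (n + 2) ≤ 1 - T := by
      have := hA1 (N + 1)
      rw [Finset.sum_range_succ'] at this
      have h0 : 0 ≤ ‖A (0 + 1)‖ ^ 2 / negBinom β (0 + 1) :=
        div_nonneg (sq_nonneg _) (negBinom_pos hβ0 _).le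
      linarith
    rw [le_div_iff₀ hT0, Finset.sum_mul]
    refine le_trans (Finset.sum_le_sum fun n _ => ?_) h2
    have hb := negBinom_pos hβ0 (n + 2)
    rw [div_mul_eq_mul_div]
    gcongr
    simp only [hc, norm_div, Complex.norm_real, Real.norm_of_nonneg hT0.le]
    have h3 := norm_inner_le_norm (𝕜 := ℂ) (A 0) (A (n + 2))
    have h4 : ‖(inner ℂ (A 0) (A (n + 2)) : ℂ)‖ ^ 2 ≤ T * ‖A (n + 2)‖ ^ 2 := by
      rw [← hT, ← mul_pow]; gcongr
    rw [div_pow, div_mul_eq_mul_div, div_le_iff₀ (by positivity)]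
    nlinarith
  have key := hyperbolicMeasure_perturbed_level_le (δ := √((1 - T) / T)) (s := t / T) hβ
    (Real.sqrt_nonneg _) hs0 ((div_lt_one hT0).2 htT) (by
      refine (abs_le_of_sq_le_sq' ?_ hs0.le).2
      rw [mul_pow, Real.sq_sqrt hδ0]; linarith) hcb
    (S := {z | z ∈ unitDisk ∧ t < ‖∑' n, z ^ n • A n‖ ^ 2 * (1 - ‖z‖ ^ 2) ^ β})
    (fun z hz => hz.1) ?_ ?_
  · rwa [Real.sq_sqrt hδ0, one_div_div] at key
  · exact measurableSet_series_level hAs β t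
  · rintro z ⟨hz, hzt⟩
    have h1 := mul_lt_mul_of_pos_right hzt (Real.rpow_pos_of_pos (hy0 z hz) (-β))
    rw [mul_assoc, hyy z hz, mul_one, hexp z hz, hser z hz, Complex.re_ofReal_mul] at h1
    have h2 := norm_series_succ_sq_le hβ0 hA1 (mem_unitDisk.1 hz)
    rw [Real.sq_sqrt hδ0, div_mul_eq_mul_div, div_mul_eq_mul_div]
    rw [div_lt_iff₀ hT0, add_mul, div_mul_cancel₀ _ hT0.ne']
    nlinarith

end

/-! ### Taylor coefficients and Bessel's inequality in `A²_α`. -/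

lemma continuousOn_pow_mul_one_sub_sq_rpow {γ : ℝ} (hγ : 0 ≤ γ) (k : ℕ) :
    ContinuousOn (fun r : ℝ => r ^ k * (1 - r ^ 2) ^ γ) (Set.Icc 0 1) :=
  (by fun_prop : Continuous fun r : ℝ => r ^ k).continuousOn.mul
    (ContinuousOn.rpow_const (by fun_prop) fun _ _ => Or.inr hγ)

/-- For `α < 0` the integrand is singular at `1`; integrability comes from the monotone primitive
`-(1 - r²)^(α + 1)`, continuous up to the endpoint. -/
lemma intervalIntegrable_pow_mul_one_sub_sq_rpow {α : ℝ} (hα : -1 < α) (n : ℕ) :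
    IntervalIntegrable (fun r : ℝ => r ^ (2 * n + 1) * (1 - r ^ 2) ^ α) volume 0 1 := by
  have h0 : IntervalIntegrable (fun r : ℝ => r * (1 - r ^ 2) ^ α) volume 0 1 := by
    have h : IntegrableOn (fun r : ℝ => 2 * (α + 1) * (r * (1 - r ^ 2) ^ α)) (Set.Ioc 0 1) := by
      refine intervalIntegral.integrableOn_deriv_of_nonneg
        (g := fun r => -(1 - r ^ 2) ^ (α + 1)) ?_ (fun r hr => ?_) fun r hr => ?_
      · have := continuousOn_pow_mul_one_sub_sq_rpow (γ := α + 1) (by linarith) 0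
        simp only [pow_zero, one_mul] at this
        exact this.neg
      · have hr2 : 0 < 1 - r ^ 2 := by nlinarith [hr.1, hr.2]
        have h2 : HasDerivAt (fun x : ℝ => 1 - x ^ 2) (-(2 * r)) r := by
          simpa using (hasDerivAt_pow 2 r).const_sub 1
        convert! (h2.rpow_const (p := α + 1) (Or.inl hr2.ne')).neg using 1
        rw [add_sub_cancel_right]; ring
      · have hr2 : 0 < 1 - r ^ 2 := by nlinarith [hr.1, hr.2]
        have := hr.1
        have : 0 < α + 1 := by linarith
        positivity
    rw [intervalIntegrable_iff_integrableOn_Ioc_of_le zero_le_one]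
    have h' := h.const_mul (1 / (2 * (α + 1)))
    refine h'.congr (Filter.Eventually.of_forall fun r => ?_)
    have : α + 1 ≠ 0 := by linarith
    simp only
    field_simp
  have h1 := h0.continuousOn_mul (g := fun r : ℝ => r ^ (2 * n)) (by fun_prop)
  refine h1.congr (fun r _ => ?_)
  simp only [pow_succ]; ring

/-- Integrating the derivative of `r^(2n) (1 - r²)^(α + 1)`, which vanishes at both ends for `n ≥
1`, gives `(n + 1) I_n = (n + α + 2) I_{n+1}`, the recursion of `1 / negBinom (α + 2) n`. -/
lemma integral_pow_mul_one_sub_sq_rpow {α : ℝ} (hα : -1 < α) (n : ℕ) :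
    ∫ r in (0 : ℝ)..1, r ^ (2 * n + 1) * (1 - r ^ 2) ^ α =
      1 / (2 * (α + 1)) / negBinom (α + 2) n := by
  have hα1 : 0 < α + 1 := by linarith
  have hder : ∀ (n : ℕ) (r : ℝ), r ∈ Set.Ioo (0 : ℝ) 1 →
      HasDerivAt (fun r : ℝ => r ^ (2 * n) * (1 - r ^ 2) ^ (α + 1))
        (2 * n * r ^ (2 * n - 1) * (1 - r ^ 2) ^ (α + 1) -
          2 * (α + 1) * (r ^ (2 * n + 1) * (1 - r ^ 2) ^ α)) r := by
    intro n r hr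
    have hr2 : 0 < 1 - r ^ 2 := by nlinarith [hr.1, hr.2]
    have h2 : HasDerivAt (fun x : ℝ => 1 - x ^ 2) (-(2 * r)) r := by
      simpa using (hasDerivAt_pow 2 r).const_sub 1
    convert! (hasDerivAt_pow (2 * n) r).mul (h2.rpow_const (p := α + 1) (Or.inl hr2.ne')) using 1
    rw [add_sub_cancel_right]; push_cast; ring
  induction n with
  | zero =>
    have h := intervalIntegral.integral_eq_sub_of_hasDerivAt_of_le zero_le_one
      (continuousOn_pow_mul_one_sub_sq_rpow (γ := α + 1) hα1.le (2 * 0)) (hder 0) (by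
        simpa using (intervalIntegrable_pow_mul_one_sub_sq_rpow hα 0).const_mul (-(2 * (α + 1))))
    simp only [Nat.cast_zero, mul_zero, zero_mul, zero_sub] at h
    rw [intervalIntegral.integral_neg, intervalIntegral.integral_const_mul] at h
    simp [Real.zero_rpow hα1.ne'] at h
    rw [negBinom_zero]
    simp only [mul_zero, zero_add, pow_one, div_one]
    rw [eq_div_iff (by positivity)]
    linarith
  | succ n ih =>
    have hI := intervalIntegrable_pow_mul_one_sub_sq_rpow hα n
    have hI' := intervalIntegrable_pow_mul_one_sub_sq_rpow hα (n + 1)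
    have hcongr : ∀ r ∈ Set.Ioo (0 : ℝ) 1, 2 * ((n + 1 : ℕ) : ℝ) * r ^ (2 * (n + 1) - 1) *
        (1 - r ^ 2) ^ (α + 1) - 2 * (α + 1) * (r ^ (2 * (n + 1) + 1) * (1 - r ^ 2) ^ α) =
        2 * (n + 1) * (r ^ (2 * n + 1) * (1 - r ^ 2) ^ α) -
          2 * (n + α + 2) * (r ^ (2 * (n + 1) + 1) * (1 - r ^ 2) ^ α) := by
      intro r hr
      have hr2 : 0 < 1 - r ^ 2 := by nlinarith [hr.1, hr.2]
      rw [Real.rpow_add_one hr2.ne', show 2 * (n + 1) - 1 = 2 * n + 1 by omega]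
      push_cast; ring
    have h := intervalIntegral.integral_eq_sub_of_hasDerivAt_of_le zero_le_one
      (continuousOn_pow_mul_one_sub_sq_rpow (γ := α + 1) hα1.le (2 * (n + 1)))
      (fun r hr => (hcongr r hr) ▸ hder (n + 1) r hr)
      ((hI.const_mul _).sub (hI'.const_mul _))
    rw [intervalIntegral.integral_sub (hI.const_mul _) (hI'.const_mul _),
      intervalIntegral.integral_const_mul, intervalIntegral.integral_const_mul, ih] at h
    set D := 1 / (2 * (α + 1)) / negBinom (α + 2) n with hD
    simp [Real.zero_rpow hα1.ne'] at h
    have hn : (0 : ℝ) ≤ n := n.cast_nonneg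
    have hb := negBinom_pos (by linarith : 0 < α + 2) n
    rw [negBinom_succ]
    set I := ∫ r in (0 : ℝ)..1, r ^ (2 * (n + 1) + 1) * (1 - r ^ 2) ^ α with hIdef
    have hne : 0 < (n : ℝ) + α + 2 := by linarith
    have h3 : I = 2 * (n + 1) * D / (2 * (n + α + 2)) := by
      rw [eq_div_iff (by positivity)]
      linarith
    rw [h3, hD]
    have hne' : α + 2 + (n : ℝ) ≠ 0 := by linarith
    field_simp
    ring

/-- Bessel's inequality on the circle for an absolutely convergent Fourier series. -/
lemma sum_sq_le_integral_norm_sq (N : ℕ) {c : ℕ → ℂ} (hc : Summable fun n => ‖c n‖) :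
    2 * Real.pi * ∑ n ∈ Finset.range N, ‖c n‖ ^ 2 ≤
      ∫ θ in (-Real.pi)..Real.pi, ‖∑' n, c n * Complex.exp (θ * Complex.I) ^ n‖ ^ 2 := by
  induction N generalizing c with
  | zero =>
    simp only [Finset.range_zero, Finset.sum_empty, mul_zero]
    exact intervalIntegral.integral_nonneg (by linarith [Real.pi_pos]) fun θ _ => sq_nonneg _
  | succ N ih =>
    have hc1 : Summable fun n => ‖c (n + 1)‖ := (summable_nat_add_iff 1).2 hc
    set G : ℝ → ℂ := fun θ => ∑' n, c (n + 1) * Complex.exp (θ * Complex.I) ^ n with hG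
    have hGc : Continuous G := continuous_tsum (fun n => by fun_prop) hc1 fun n θ => by
      simp [Complex.norm_exp_ofReal_mul_I]
    have hsplit : ∀ θ : ℝ, ∑' n, c n * Complex.exp (θ * Complex.I) ^ n =
        c 0 + Complex.exp (θ * Complex.I) * G θ := by
      intro θ
      have hs : Summable fun n => c n * Complex.exp (θ * Complex.I) ^ n :=
        Summable.of_norm (by simpa [Complex.norm_exp_ofReal_mul_I] using hc)
      rw [hs.tsum_eq_zero_add, hG, ← tsum_mul_left]
      simp only [pow_zero, mul_one]
      congr 1
      refine tsum_congr fun n => ?_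
      rw [pow_succ]; ring
    -- One coefficient is peeled off at a time: the cross term has mean zero, and `G` carries the
    -- shifted coefficients.
    have hnorm : ∀ θ : ℝ, ‖∑' n, c n * Complex.exp (θ * Complex.I) ^ n‖ ^ 2 =
        ‖c 0‖ ^ 2 + 2 * ((starRingEnd ℂ) (c 0) * (Complex.exp (θ * Complex.I) * G θ)).re +
          ‖G θ‖ ^ 2 := by
      intro θ
      rw [hsplit, @norm_add_sq ℂ, norm_mul, Complex.norm_exp_ofReal_mul_I, one_mul]
      simp [mul_comm]
    have hmean : ∫ θ in (-Real.pi)..Real.pi, Complex.exp (θ * Complex.I) * G θ = 0 := by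
      rw [← integral_series_exp_eq_zero hc1 0]
      refine intervalIntegral.integral_congr fun θ _ => ?_
      simp only [hG, ← tsum_mul_left]
      refine tsum_congr fun n => ?_
      rw [add_zero, pow_succ]; ring
    have hEG : Continuous fun θ : ℝ => Complex.exp (θ * Complex.I) * G θ := by fun_prop
    have hre : ∫ θ in (-Real.pi)..Real.pi,
        ((starRingEnd ℂ) (c 0) * (Complex.exp (θ * Complex.I) * G θ)).re = 0 := by
      have := Complex.reCLM.intervalIntegral_comp_comm (μ := volume)
        ((hEG.const_mul ((starRingEnd ℂ) (c 0))).intervalIntegrable (-Real.pi) Real.pi)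
      simp only [Complex.reCLM_apply] at this
      rw [this, intervalIntegral.integral_const_mul, hmean]
      simp
    simp only [hnorm]
    rw [intervalIntegral.integral_add
      (Continuous.intervalIntegrable (by fun_prop) _ _)
      (Continuous.intervalIntegrable (by fun_prop) _ _),
      intervalIntegral.integral_add (Continuous.intervalIntegrable (by fun_prop) _ _)
      (Continuous.intervalIntegrable (by fun_prop) _ _),
      intervalIntegral.integral_const_mul, hre, intervalIntegral.integral_const, smul_eq_mul,
      Finset.sum_range_succ']
    have := ih hc1
    linarith

noncomputable section

/-- The Taylor coefficients at the origin. -/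
def taylorCoeff (f : ℂ → ℂ) (n : ℕ) : ℂ := (n.factorial : ℂ)⁻¹ * iteratedDeriv n f 0

lemma hasSum_taylorCoeff {f : ℂ → ℂ} (hf : DifferentiableOn ℂ f unitDisk) {z : ℂ}
    (hz : z ∈ unitDisk) : HasSum (fun n => taylorCoeff f n * z ^ n) (f z) := by
  have h := Complex.hasSum_taylorSeries_on_ball (f := f) (c := 0) (r := 1) (z := z)
    (by simpa [unitDisk] using hf) (by simpa [unitDisk] using hz)
  refine h.congr_fun fun n => ?_
  simp [taylorCoeff]; ring

lemma summable_norm_taylorCoeff {f : ℂ → ℂ} (hf : DifferentiableOn ℂ f unitDisk) {r : ℝ}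
    (hr0 : 0 ≤ r) (hr1 : r < 1) : Summable fun n => ‖taylorCoeff f n‖ * r ^ n := by
  have h := (hasSum_taylorCoeff hf (z := r) (by simpa [unitDisk, abs_of_nonneg hr0])).summable.norm
  simpa [abs_of_nonneg hr0] using h

lemma integral_circle_ge {f : ℂ → ℂ} (hf : DifferentiableOn ℂ f unitDisk) {r : ℝ}
    (hr0 : 0 ≤ r) (hr1 : r < 1) (N : ℕ) :
    2 * Real.pi * ∑ n ∈ Finset.range N, ‖taylorCoeff f n‖ ^ 2 * r ^ (2 * n) ≤
      ∫ θ in (-Real.pi)..Real.pi, ‖f ((r : ℂ) * Complex.exp (θ * Complex.I))‖ ^ 2 := by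
  have hn : ∀ n, ‖taylorCoeff f n * (r : ℂ) ^ n‖ = ‖taylorCoeff f n‖ * r ^ n := by
    intro n; simp [abs_of_nonneg hr0]
  have h := sum_sq_le_integral_norm_sq N (c := fun n => taylorCoeff f n * (r : ℂ) ^ n)
    (by simpa only [hn] using summable_norm_taylorCoeff hf hr0 hr1)
  simp only [hn, mul_pow, ← pow_mul] at h
  refine le_trans (le_of_eq ?_) (h.trans (le_of_eq ?_))
  · congr 1
    exact Finset.sum_congr rfl fun n _ => by rw [mul_comm 2 n]
  · refine intervalIntegral.integral_congr fun θ _ => ?_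
    rw [← (hasSum_taylorCoeff hf (z := (r : ℂ) * Complex.exp (θ * Complex.I)) ?_).tsum_eq]
    · congr 2
      refine tsum_congr fun n => ?_
      rw [mul_pow]; ring
    · rw [mem_unitDisk]
      simpa [Complex.norm_exp_ofReal_mul_I, abs_of_nonneg hr0]

/-- Bessel's inequality in the weighted Bergman space. -/
theorem sum_taylorCoeff_le_one {α : ℝ} (hα : -1 < α) {f : ℂ → ℂ}
    (hf : DifferentiableOn ℂ f unitDisk)
    (hnorm : ∫⁻ z in unitDisk, ENNReal.ofReal (‖f z‖ ^ 2 * (1 - ‖z‖ ^ 2) ^ α) ≤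
      ENNReal.ofReal (Real.pi / (α + 1))) (N : ℕ) :
    ∑ n ∈ Finset.range N, ‖taylorCoeff f n‖ ^ 2 / negBinom (α + 2) n ≤ 1 := by
  have hα1 : 0 < α + 1 := by linarith
  set g : ℂ → ENNReal := unitDisk.indicator
    fun z => ENNReal.ofReal (‖f z‖ ^ 2 * (1 - ‖z‖ ^ 2) ^ α) with hg
  have hgm : Measurable g := by
    have hc : ContinuousOn (fun z : ℂ => ENNReal.ofReal (‖f z‖ ^ 2 * (1 - ‖z‖ ^ 2) ^ α))
        unitDisk := by
      refine ENNReal.continuous_ofReal.comp_continuousOn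
        ((hf.continuousOn.norm.pow 2).mul (ContinuousOn.rpow_const (by fun_prop) fun z hz => ?_))
      have := mem_unitDisk.1 hz
      exact Or.inl (by nlinarith [norm_nonneg z])
    classical
    have := hc.measurable_piecewise (g := fun _ => (0 : ENNReal)) continuousOn_const
      measurableSet_unitDisk
    rw [hg, ← Set.piecewise_eq_indicator]
    exact this
  have hpm : Measurable fun p : ℝ × ℝ => Complex.polarCoord.symm p := by
    simp only [Complex.polarCoord_symm_apply]; fun_prop
  -- Bessel's inequality on each circle, multiplied by the polar Jacobian and the weight.
  have hlow : ∀ r ∈ Set.Ioo (0 : ℝ) 1,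
      ENNReal.ofReal (∑ n ∈ Finset.range N, 2 * Real.pi * ‖taylorCoeff f n‖ ^ 2 *
        (r ^ (2 * n + 1) * (1 - r ^ 2) ^ α)) ≤
      ∫⁻ θ in Set.Ioo (-Real.pi) Real.pi,
        ENNReal.ofReal r • g (Complex.polarCoord.symm (r, θ)) := by
    intro r hr
    have hr2 : 0 < 1 - r ^ 2 := by nlinarith [hr.1, hr.2]
    have hw : 0 ≤ r * (1 - r ^ 2) ^ α := mul_nonneg hr.1.le (Real.rpow_nonneg hr2.le _)
    have hmem : ∀ θ : ℝ, (r : ℂ) * Complex.exp (θ * Complex.I) ∈ unitDisk := by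
      intro θ
      rw [mem_unitDisk]
      simpa [Complex.norm_exp_ofReal_mul_I, abs_of_pos hr.1] using hr.2
    have hcirc : Continuous fun θ : ℝ => f ((r : ℂ) * Complex.exp (θ * Complex.I)) :=
      hf.continuousOn.comp_continuous (by fun_prop) hmem
    have he : ∀ θ : ℝ, ENNReal.ofReal r • g (Complex.polarCoord.symm (r, θ)) =
        ENNReal.ofReal (r * (1 - r ^ 2) ^ α *
          ‖f ((r : ℂ) * Complex.exp (θ * Complex.I))‖ ^ 2) := by
      intro θ
      have hz : Complex.polarCoord.symm (r, θ) = (r : ℂ) * Complex.exp (θ * Complex.I) := by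
        rw [Complex.polarCoord_symm_apply, Complex.exp_mul_I]
        simp
      have hn : ‖(r : ℂ) * Complex.exp (θ * Complex.I)‖ = r := by
        simp [Complex.norm_exp_ofReal_mul_I, abs_of_pos hr.1]
      rw [hz, hg, Set.indicator_of_mem (hmem θ), hn, smul_eq_mul, ← ENNReal.ofReal_mul hr.1.le]
      congr 1; ring
    simp only [he]
    have hcont : Continuous fun θ : ℝ => r * (1 - r ^ 2) ^ α *
        ‖f ((r : ℂ) * Complex.exp (θ * Complex.I))‖ ^ 2 :=
      continuous_const.mul (hcirc.norm.pow 2)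
    rw [Measure.restrict_congr_set Ioo_ae_eq_Ioc, ← ofReal_integral_eq_lintegral_ofReal
      hcont.integrableOn_Ioc (Filter.Eventually.of_forall fun θ =>
        mul_nonneg hw (sq_nonneg _)),
      ← intervalIntegral.integral_of_le (by linarith [Real.pi_pos]),
      intervalIntegral.integral_const_mul]
    refine ENNReal.ofReal_le_ofReal (le_trans (le_of_eq ?_)
      (mul_le_mul_of_nonneg_left (integral_circle_ge hf hr.1.le hr.2 N) hw))
    rw [Finset.mul_sum, Finset.mul_sum]
    refine Finset.sum_congr rfl fun n _ => ?_
    rw [pow_succ]; ring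
  have hint : IntervalIntegrable (fun r : ℝ => ∑ n ∈ Finset.range N,
      2 * Real.pi * ‖taylorCoeff f n‖ ^ 2 * (r ^ (2 * n + 1) * (1 - r ^ 2) ^ α)) volume 0 1 := by
    have h := IntervalIntegrable.sum (Finset.range N) fun n _ =>
      (intervalIntegrable_pow_mul_one_sub_sq_rpow hα n).const_mul
        (2 * Real.pi * ‖taylorCoeff f n‖ ^ 2)
    convert! h using 1
    ext r
    simp
  have hchain : ENNReal.ofReal (∑ n ∈ Finset.range N, 2 * Real.pi * ‖taylorCoeff f n‖ ^ 2 *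
      (1 / (2 * (α + 1)) / negBinom (α + 2) n)) ≤ ENNReal.ofReal (Real.pi / (α + 1)) := by
    refine le_trans ?_ hnorm
    rw [← lintegral_indicator measurableSet_unitDisk, ← hg,
      ← Complex.lintegral_comp_polarCoord_symm, polarCoord_target, Measure.volume_eq_prod,
      ← Measure.prod_restrict, lintegral_prod _ (by
        refine Measurable.aemeasurable ?_
        exact (ENNReal.measurable_ofReal.comp measurable_fst).smul (hgm.comp hpm))]
    refine le_trans ?_ (lintegral_mono_set (s := Set.Ioo 0 1) Set.Ioo_subset_Ioi_self)
    refine le_trans ?_ (setLIntegral_mono' measurableSet_Ioo hlow)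
    rw [Measure.restrict_congr_set Ioo_ae_eq_Ioc, ← ofReal_integral_eq_lintegral_ofReal
      ((intervalIntegrable_iff_integrableOn_Ioc_of_le zero_le_one).1 hint)
      (by
        filter_upwards [ae_restrict_mem measurableSet_Ioc] with r hr
        refine Finset.sum_nonneg fun n _ => ?_
        have hr2 : 0 ≤ 1 - r ^ 2 := by nlinarith [hr.1, hr.2]
        have := hr.1.le
        have := Real.rpow_nonneg hr2 α
        positivity),
      ← intervalIntegral.integral_of_le zero_le_one, intervalIntegral.integral_finsetSum
        fun n _ => (intervalIntegrable_pow_mul_one_sub_sq_rpow hα n).const_mul _]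
    simp only [intervalIntegral.integral_const_mul, integral_pow_mul_one_sub_sq_rpow hα]
    exact le_rfl
  rw [ENNReal.ofReal_le_ofReal_iff (by positivity)] at hchain
  have hfac : ∑ n ∈ Finset.range N, 2 * Real.pi * ‖taylorCoeff f n‖ ^ 2 *
      (1 / (2 * (α + 1)) / negBinom (α + 2) n) =
      Real.pi / (α + 1) * ∑ n ∈ Finset.range N, ‖taylorCoeff f n‖ ^ 2 / negBinom (α + 2) n := by
    rw [Finset.mul_sum]
    refine Finset.sum_congr rfl fun n _ => ?_
    have := negBinom_pos (by linarith : 0 < α + 2) n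
    field_simp
  rw [hfac] at hchain
  exact le_of_mul_le_mul_left (by rwa [mul_one]) (by positivity : 0 < Real.pi / (α + 1))

end

/-! ### Disk involutions and their action on `A²_α`. -/

noncomputable section

/-- The involutive automorphism of the disk exchanging `0` and `a`. -/
def diskInvolution (a z : ℂ) : ℂ := (a - z) / (1 - (starRingEnd ℂ) a * z)

/-- Keeps `1 - conj a * z` in the right half plane, so that its principal logarithm, and hence
`bergmanPullback`, is holomorphic for real `β`. -/
lemma one_sub_conj_mul_re_pos {a z : ℂ} (ha : a ∈ unitDisk) (hz : z ∈ unitDisk) :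
    0 < (1 - (starRingEnd ℂ) a * z).re := by
  rw [mem_unitDisk] at ha hz
  have h : ‖(starRingEnd ℂ) a * z‖ < 1 := by
    rw [norm_mul, RCLike.norm_conj]
    nlinarith [norm_nonneg a, norm_nonneg z]
  have := Complex.re_le_norm ((starRingEnd ℂ) a * z)
  simp only [Complex.sub_re, Complex.one_re]
  linarith

lemma one_sub_conj_mul_ne_zero {a z : ℂ} (ha : a ∈ unitDisk) (hz : z ∈ unitDisk) :
    1 - (starRingEnd ℂ) a * z ≠ 0 := by
  intro h
  have := one_sub_conj_mul_re_pos ha hz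
  rw [h] at this
  simp at this

lemma one_sub_norm_sq_pos {z : ℂ} (hz : z ∈ unitDisk) : 0 < 1 - ‖z‖ ^ 2 := by
  have := mem_unitDisk.1 hz
  nlinarith [norm_nonneg z]

lemma one_sub_norm_diskInvolution_sq {a z : ℂ} (ha : a ∈ unitDisk) (hz : z ∈ unitDisk) :
    1 - ‖diskInvolution a z‖ ^ 2 =
      (1 - ‖a‖ ^ 2) * (1 - ‖z‖ ^ 2) / ‖1 - (starRingEnd ℂ) a * z‖ ^ 2 := by
  have h := norm_pos_iff.2 (one_sub_conj_mul_ne_zero ha hz)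
  rw [diskInvolution, norm_div, div_pow, eq_div_iff (by positivity), sub_mul,
    div_mul_cancel₀ _ (by positivity)]
  simp only [← Complex.normSq_eq_norm_sq, Complex.normSq_apply, Complex.sub_re, Complex.sub_im,
    Complex.mul_re, Complex.mul_im, Complex.conj_re, Complex.conj_im, Complex.one_re,
    Complex.one_im]
  ring

lemma diskInvolution_mem {a z : ℂ} (ha : a ∈ unitDisk) (hz : z ∈ unitDisk) :
    diskInvolution a z ∈ unitDisk := by
  have h := norm_pos_iff.2 (one_sub_conj_mul_ne_zero ha hz)
  have h1 := one_sub_norm_diskInvolution_sq ha hz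
  have h2 : 0 < (1 - ‖a‖ ^ 2) * (1 - ‖z‖ ^ 2) / ‖1 - (starRingEnd ℂ) a * z‖ ^ 2 := by
    have := one_sub_norm_sq_pos ha
    have := one_sub_norm_sq_pos hz
    positivity
  rw [mem_unitDisk]
  nlinarith [norm_nonneg (diskInvolution a z)]

lemma diskInvolution_diskInvolution {a z : ℂ} (ha : a ∈ unitDisk) (hz : z ∈ unitDisk) :
    diskInvolution a (diskInvolution a z) = z := by
  have h := one_sub_conj_mul_ne_zero ha hz
  have h2 := one_sub_conj_mul_ne_zero ha (diskInvolution_mem ha hz)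
  rw [diskInvolution, div_eq_iff h2]
  simp only [diskInvolution]
  set q := 1 - (starRingEnd ℂ) a * z with hq
  field_simp
  rw [hq]
  ring

lemma diskInvolution_zero (a : ℂ) : diskInvolution a 0 = a := by simp [diskInvolution]

lemma hasDerivAt_diskInvolution {a z : ℂ} (ha : a ∈ unitDisk) (hz : z ∈ unitDisk) :
    HasDerivAt (diskInvolution a)
      (-(1 - (starRingEnd ℂ) a * a) / (1 - (starRingEnd ℂ) a * z) ^ 2) z := by
  have h := one_sub_conj_mul_ne_zero ha hz
  have h1 : HasDerivAt (fun z : ℂ => a - z) (-1) z := by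
    simpa using (hasDerivAt_id z).const_sub a
  have h2 : HasDerivAt (fun z : ℂ => 1 - (starRingEnd ℂ) a * z) (-(starRingEnd ℂ) a) z := by
    simpa using ((hasDerivAt_id z).const_mul ((starRingEnd ℂ) a)).const_sub 1
  convert! h1.div h2 h using 1
  ring

lemma injOn_diskInvolution {a : ℂ} (ha : a ∈ unitDisk) :
    Set.InjOn (diskInvolution a) unitDisk := by
  intro z hz w hw h
  rw [← diskInvolution_diskInvolution ha hz, h, diskInvolution_diskInvolution ha hw]

lemma det_restrictScalars_toSpanSingleton (w : ℂ) :
    ((ContinuousLinearMap.toSpanSingleton ℂ w).restrictScalars ℝ).det = ‖w‖ ^ 2 := by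
  have h := Algebra.norm_complex_apply w
  rw [Algebra.norm_apply] at h
  rw [← Complex.normSq_eq_norm_sq, ← h, ContinuousLinearMap.det]
  congr 1
  ext
  simp [mul_comm]

/-- Invariance of the hyperbolic area element under disk involutions. -/
lemma setLIntegral_image_diskInvolution {a : ℂ} (ha : a ∈ unitDisk) {S : Set ℂ}
    (hS : S ⊆ unitDisk) (hSm : MeasurableSet S) (g : ℂ → ENNReal) :
    ∫⁻ w in diskInvolution a '' S, ENNReal.ofReal (1 / (1 - ‖w‖ ^ 2) ^ 2) * g w =
      ∫⁻ z in S, ENNReal.ofReal (1 / (1 - ‖z‖ ^ 2) ^ 2) * g (diskInvolution a z) := by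
  rw [lintegral_image_eq_lintegral_abs_det_fderiv_mul volume hSm
    (fun z hz => ((hasDerivAt_diskInvolution ha (hS hz)).hasFDerivAt.restrictScalars
      ℝ).hasFDerivWithinAt) ((injOn_diskInvolution ha).mono hS)]
  refine setLIntegral_congr_fun hSm fun z hz => ?_
  have hz := hS hz
  have h := norm_pos_iff.2 (one_sub_conj_mul_ne_zero ha hz)
  have h1 := one_sub_norm_sq_pos ha
  have h2 := one_sub_norm_sq_pos hz
  have h3 : ‖1 - (starRingEnd ℂ) a * a‖ = 1 - ‖a‖ ^ 2 := by
    rw [Complex.conj_mul', ← Complex.ofReal_pow, ← Complex.ofReal_one, ← Complex.ofReal_sub,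
      Complex.norm_real, Real.norm_of_nonneg h1.le]
  rw [← mul_assoc, ← ENNReal.ofReal_mul (abs_nonneg _), det_restrictScalars_toSpanSingleton,
    one_sub_norm_diskInvolution_sq ha hz, norm_div, norm_neg, norm_pow, h3]
  congr 2
  rw [abs_of_nonneg (by positivity)]
  field_simp

/-- The action of the disk involution on `A²_α`, up to a unimodular constant; `β = α + 2`. -/
def bergmanPullback (β : ℝ) (a : ℂ) (f : ℂ → ℂ) (z : ℂ) : ℂ :=
  f (diskInvolution a z) * (((1 - ‖a‖ ^ 2) ^ (β / 2) : ℝ) *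
    Complex.exp (-β * Complex.log (1 - (starRingEnd ℂ) a * z)))

lemma differentiableOn_bergmanPullback (β : ℝ) {a : ℂ} (ha : a ∈ unitDisk) {f : ℂ → ℂ}
    (hf : DifferentiableOn ℂ f unitDisk) : DifferentiableOn ℂ (bergmanPullback β a f) unitDisk := by
  refine DifferentiableOn.mul ?_ (DifferentiableOn.const_mul ?_ _)
  · exact hf.comp (fun z hz => (hasDerivAt_diskInvolution ha
      hz).differentiableAt.differentiableWithinAt) fun z hz => diskInvolution_mem ha hz
  · refine DifferentiableOn.cexp (DifferentiableOn.const_mul (DifferentiableOn.clog ?_ ?_) _)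
    · fun_prop
    · exact fun z hz => Or.inl (one_sub_conj_mul_re_pos ha hz)

lemma norm_bergmanPullback_sq_mul {β : ℝ} {a z : ℂ} (ha : a ∈ unitDisk) (hz : z ∈ unitDisk)
    (f : ℂ → ℂ) : ‖bergmanPullback β a f z‖ ^ 2 * (1 - ‖z‖ ^ 2) ^ β =
      ‖f (diskInvolution a z)‖ ^ 2 * (1 - ‖diskInvolution a z‖ ^ 2) ^ β := by
  have h := norm_pos_iff.2 (one_sub_conj_mul_ne_zero ha hz)
  have h1 := one_sub_norm_sq_pos ha
  have h2 := one_sub_norm_sq_pos hz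
  have h3 : ‖Complex.exp (-β * Complex.log (1 - (starRingEnd ℂ) a * z))‖ =
      ‖1 - (starRingEnd ℂ) a * z‖ ^ (-β) := by
    rw [Complex.norm_exp, Real.rpow_def_of_pos h]
    congr 1
    rw [← Complex.ofReal_neg, Complex.re_ofReal_mul, Complex.log_re]; ring
  rw [one_sub_norm_diskInvolution_sq ha hz, Real.div_rpow (by positivity) (by positivity),
    Real.mul_rpow h1.le h2.le, bergmanPullback, norm_mul, norm_mul, h3, Complex.norm_real,
    Real.norm_of_nonneg (Real.rpow_nonneg h1.le _)]
  have e1 : ((1 - ‖a‖ ^ 2) ^ (β / 2)) ^ 2 = (1 - ‖a‖ ^ 2) ^ β := by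
    rw [sq, ← Real.rpow_add h1]; congr 1; ring
  have e2 : (‖1 - (starRingEnd ℂ) a * z‖ ^ (-β)) ^ 2 = ((‖1 - (starRingEnd ℂ) a * z‖ ^ 2) ^ β)⁻¹ := by
    rw [← Real.rpow_neg (by positivity), ← Real.rpow_natCast _ 2, ← Real.rpow_natCast _ 2,
      ← Real.rpow_mul h.le, ← Real.rpow_mul h.le]
    congr 1; push_cast; ring
  rw [mul_pow, mul_pow, e1, e2]
  ring

lemma bergmanDensity_bergmanPullback {α : ℝ} {a z : ℂ} (ha : a ∈ unitDisk) (hz : z ∈ unitDisk)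
    (f : ℂ → ℂ) : bergmanDensity α (bergmanPullback (α + 2) a f) z =
      bergmanDensity α f (diskInvolution a z) :=
  norm_bergmanPullback_sq_mul ha hz f

lemma image_diskInvolution_unitDisk {a : ℂ} (ha : a ∈ unitDisk) :
    diskInvolution a '' unitDisk = unitDisk := by
  ext w
  exact ⟨by rintro ⟨z, hz, rfl⟩; exact diskInvolution_mem ha hz, fun hw =>
    ⟨_, diskInvolution_mem ha hw, diskInvolution_diskInvolution ha hw⟩⟩

/-- Written against the invariant area, the norm involves only the density, so its invariance
reduces to a change of variables. -/
lemma setLIntegral_bergman_eq (α : ℝ) (f : ℂ → ℂ) :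
    ∫⁻ z in unitDisk, ENNReal.ofReal (‖f z‖ ^ 2 * (1 - ‖z‖ ^ 2) ^ α) =
      ∫⁻ z in unitDisk, ENNReal.ofReal (1 / (1 - ‖z‖ ^ 2) ^ 2) *
        ENNReal.ofReal (bergmanDensity α f z) := by
  refine setLIntegral_congr_fun measurableSet_unitDisk fun z hz => ?_
  have h := one_sub_norm_sq_pos hz
  rw [← ENNReal.ofReal_mul (by positivity), bergmanDensity, Real.rpow_add h, Real.rpow_two]
  congr 1
  field_simp

lemma setLIntegral_bergmanPullback {α : ℝ} {a : ℂ} (ha : a ∈ unitDisk) (f : ℂ → ℂ) :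
    ∫⁻ z in unitDisk, ENNReal.ofReal
        (‖bergmanPullback (α + 2) a f z‖ ^ 2 * (1 - ‖z‖ ^ 2) ^ α) =
      ∫⁻ z in unitDisk, ENNReal.ofReal (‖f z‖ ^ 2 * (1 - ‖z‖ ^ 2) ^ α) := by
  rw [setLIntegral_bergman_eq, setLIntegral_bergman_eq]
  conv_rhs => rw [← image_diskInvolution_unitDisk ha]
  rw [setLIntegral_image_diskInvolution ha subset_rfl measurableSet_unitDisk
    (fun w => ENNReal.ofReal (bergmanDensity α f w))]
  refine setLIntegral_congr_fun measurableSet_unitDisk fun z hz => ?_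
  rw [bergmanDensity_bergmanPullback ha hz]

lemma hyperbolicMeasure_image_diskInvolution {a : ℂ} (ha : a ∈ unitDisk) {S : Set ℂ}
    (hS : S ⊆ unitDisk) (hSm : MeasurableSet S) :
    hyperbolicMeasure (diskInvolution a '' S) = hyperbolicMeasure S := by
  rw [hyperbolicMeasure_eq_setLIntegral hS, hyperbolicMeasure_eq_setLIntegral]
  · simpa using setLIntegral_image_diskInvolution ha hS hSm fun _ => 1
  · rintro _ ⟨z, hz, rfl⟩
    exact diskInvolution_mem ha (hS hz)

lemma setLIntegral_eq_of_bergmanNorm_eq_one {α : ℝ} (hα : -1 < α) {f : ℂ → ℂ}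
    (hf : MemBergman α f) (hn : bergmanNorm α f = 1) :
    ∫⁻ z in unitDisk, ENNReal.ofReal (‖f z‖ ^ 2 * (1 - ‖z‖ ^ 2) ^ α) =
      ENNReal.ofReal (Real.pi / (α + 1)) := by
  have hα1 : 0 < α + 1 := by linarith
  rw [← ofReal_integral_eq_lintegral_ofReal hf.2]
  · rw [bergmanNorm, Real.sqrt_eq_one] at hn
    congr 1
    rw [eq_div_iff hα1.ne']
    field_simp at hn
    linarith
  · filter_upwards [ae_restrict_mem measurableSet_unitDisk] with z hz
    exact mul_nonneg (sq_nonneg _) (Real.rpow_nonneg (one_sub_norm_sq_pos hz).le _)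

end

/-! ### Reduction of the covariant symbol to an `ℓ²`-valued series, and the conclusion. -/

lemma lp_two_norm_sq (x : lp (fun _ : ℕ => ℂ) 2) : ‖x‖ ^ 2 = ∑' j, ‖x j‖ ^ 2 := by
  have h := lp.norm_rpow_eq_tsum (p := 2) (by norm_num) x
  simpa using h

/-- The area estimate for the covariant symbol, with an explicit smallness condition. -/
theorem superlevelMeasure_covariantSymbol_le {α : ℝ} (hα : -1 < α) {p : ℕ → ℝ}
    {f : ℕ → ℂ → ℂ} (hp : ∀ j, 0 ≤ p j) (hp1 : HasSum p 1) (hf : ∀ j, MemBergman α (f j))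
    (hn : ∀ j, bergmanNorm α (f j) = 1) {t T : ℝ}
    (hT : IsGreatest (covariantSymbol α p f '' unitDisk) T) (ht0 : 0 < t) (htT : t < T)
    (hsmall : T ≤ 1 → 36 * ((1 - T) / T) ≤ (t / T) ^ 2) :
    T ≤ 1 ∧ superlevelMeasure (covariantSymbol α p f) t ≤
      ENNReal.ofReal (Real.pi * (1 + 14 * ((1 - T) / T) / (t / T) ^ 2) *
        ((T / t) ^ (1 / (α + 2)) - 1)) := by
  obtain ⟨⟨a, ha, haT⟩, hub⟩ := hT
  have hβ0 : 0 < α + 2 := by linarith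
  -- All `f j` are moved by the same involution, the one taking `0` to the maximum point `a` of the
  -- mixture.
  set F : ℕ → ℂ → ℂ := fun j => bergmanPullback (α + 2) a (f j) with hF
  have hFd : ∀ j, DifferentiableOn ℂ (F j) unitDisk := fun j =>
    differentiableOn_bergmanPullback _ ha (hf j).1
  have hbes : ∀ j N, ∑ n ∈ Finset.range N, ‖taylorCoeff (F j) n‖ ^ 2 / negBinom (α + 2) n ≤ 1 :=
    fun j N => sum_taylorCoeff_le_one hα (hFd j) (by
      rw [hF, setLIntegral_bergmanPullback ha, setLIntegral_eq_of_bergmanNorm_eq_one hα (hf j)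
        (hn j)]) N
  have hcoef : ∀ j n, ‖taylorCoeff (F j) n‖ ^ 2 ≤ negBinom (α + 2) n := by
    intro j n
    have h := hbes j (n + 1)
    rw [Finset.sum_range_succ] at h
    have h0 : 0 ≤ ∑ k ∈ Finset.range n, ‖taylorCoeff (F j) k‖ ^ 2 / negBinom (α + 2) k :=
      Finset.sum_nonneg fun k _ => div_nonneg (sq_nonneg _) (negBinom_pos hβ0 k).le
    rw [← div_le_one (negBinom_pos hβ0 n)]
    linarith
  have hterm : ∀ n j, ‖((√(p j) : ℝ) : ℂ) * taylorCoeff (F j) n‖ ^ 2 =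
      p j * ‖taylorCoeff (F j) n‖ ^ 2 := by
    intro n j
    rw [norm_mul, mul_pow, Complex.norm_real, Real.norm_of_nonneg (Real.sqrt_nonneg _),
      Real.sq_sqrt (hp j)]
  have hsum : ∀ n, Summable fun j => p j * ‖taylorCoeff (F j) n‖ ^ 2 := fun n =>
    Summable.of_nonneg_of_le (fun j => mul_nonneg (hp j) (sq_nonneg _))
      (fun j => mul_le_mul_of_nonneg_left (hcoef j n) (hp j)) (hp1.summable.mul_right _)
  -- The weights `√(p j)` make the squared `ℓ²` norm of the series reproduce the sum over `j`.
  set A : ℕ → lp (fun _ : ℕ => ℂ) 2 := fun n =>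
    ⟨fun j => ((√(p j) : ℝ) : ℂ) * taylorCoeff (F j) n, memℓp_gen (by
      have h := hsum n
      simp only [← hterm n] at h
      simpa using h)⟩ with hA
  have hAapp : ∀ n j, A n j = ((√(p j) : ℝ) : ℂ) * taylorCoeff (F j) n := fun n j => rfl
  have hAnorm : ∀ n, ‖A n‖ ^ 2 = ∑' j, p j * ‖taylorCoeff (F j) n‖ ^ 2 := by
    intro n
    rw [lp_two_norm_sq]
    exact tsum_congr fun j => by rw [hAapp, hterm]
  have hA1 : ∀ N, ∑ n ∈ Finset.range N, ‖A n‖ ^ 2 / negBinom (α + 2) n ≤ 1 := by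
    intro N
    simp only [hAnorm, ← tsum_div_const]
    rw [← Summable.tsum_finsetSum fun n _ => (hsum n).div_const _, ← hp1.tsum_eq]
    refine Summable.tsum_le_tsum (fun j => ?_)
      (summable_sum fun n _ => (hsum n).div_const _) hp1.summable
    simp only [mul_div_assoc]
    rw [← Finset.mul_sum]
    exact mul_le_of_le_one_right (hp j) (hbes j N)
  have hAs : ∀ r : ℝ, 0 ≤ r → r < 1 → Summable fun n => ‖A n‖ * r ^ n := fun r h0 h1 =>
    summable_norm_mul_pow hβ0 hA1 h0 h1
  have hser : ∀ z ∈ unitDisk, ∀ j, (∑' n, z ^ n • A n) j = ((√(p j) : ℝ) : ℂ) * F j z := by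
    intro z hz j
    have h := (lp.evalCLM (𝕜 := ℂ) (fun _ : ℕ => ℂ) 2 j).map_tsum
      (summable_pow_smul hAs (mem_unitDisk.1 hz))
    change (∑' n, z ^ n • A n) j = ∑' n, z ^ n • A n j at h
    rw [h, ← (hasSum_taylorCoeff (hFd j) hz).tsum_eq, ← tsum_mul_left]
    refine tsum_congr fun n => ?_
    rw [hAapp, smul_eq_mul]; ring
  have hU : ∀ z ∈ unitDisk, ‖∑' n, z ^ n • A n‖ ^ 2 * (1 - ‖z‖ ^ 2) ^ (α + 2) =
      covariantSymbol α p f (diskInvolution a z) := by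
    intro z hz
    rw [lp_two_norm_sq, ← tsum_mul_right, covariantSymbol]
    refine tsum_congr fun j => ?_
    rw [← bergmanDensity_bergmanPullback ha hz, hser z hz, norm_mul, mul_pow, Complex.norm_real,
      Real.norm_of_nonneg (Real.sqrt_nonneg _), Real.sq_sqrt (hp j), bergmanDensity, mul_assoc]
  have h0 : (0 : ℂ) ∈ unitDisk := by simp [unitDisk]
  have hT0 : ‖A 0‖ ^ 2 = T := by
    have h := hU 0 h0
    rw [diskInvolution_zero, haT, tsum_eq_single 0 (by intro n hn; simp [hn])] at h
    simpa using h
  -- The one-term case of Bessel's inequality. It becomes available only here, which is why `hsmall`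
  -- is conditional on it.
  have hT1 : T ≤ 1 := by simpa [negBinom_zero, hT0] using hA1 1
  refine ⟨hT1, ?_⟩
  have hkey := hyperbolicMeasure_series_level_le (by linarith : 1 ≤ α + 2) hA1 hT0
    (fun z hz => by
      rw [hU z hz]; exact hub ⟨_, diskInvolution_mem ha hz, rfl⟩) ht0 htT (hsmall hT1)
  rw [← hyperbolicMeasure_image_diskInvolution ha (fun z hz => hz.1)
    (measurableSet_series_level hAs _ _)] at hkey
  rw [superlevelMeasure]
  convert hkey using 2
  ext w
  constructor
  · rintro ⟨hw, hwt⟩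
    have hw' := diskInvolution_mem ha hw
    refine ⟨diskInvolution a w, ⟨hw', ?_⟩, diskInvolution_diskInvolution ha hw⟩
    rwa [hU _ hw', diskInvolution_diskInvolution ha hw]
  · rintro ⟨z, ⟨hz, hzt⟩, rfl⟩
    exact ⟨diskInvolution_mem ha hz, by rwa [← hU z hz]⟩

lemma covariantSymbol_single (α : ℝ) (f : ℂ → ℂ) :
    covariantSymbol α (Pi.single 0 1) (fun _ => f) = bergmanDensity α f := by
  ext z
  rw [covariantSymbol, tsum_eq_single 0 (by intro j hj; simp [hj])]
  simp


theorem mainTheorem5 :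
    ∃ C : ℝ, 0 < C ∧
      ∀ t₀ : ℝ, 0 < t₀ → t₀ < 1 →
        ∃ T₀ : ℝ, t₀ < T₀ ∧ T₀ < 1 ∧
          ∀ α : ℝ, -1 < α →
            -- a single function of norm one
            (∀ f : ℂ → ℂ, MemBergman α f → bergmanNorm α f = 1 →
              ∀ T : ℝ, IsGreatest (bergmanDensity α f '' unitDisk) T → T₀ ≤ T →
                ∀ t : ℝ, t₀ < t → t < T →
                  superlevelMeasure (bergmanDensity α f) t ≤
                    ENNReal.ofReal (Real.pi * ((1 + C * t₀ ^ (-3 : ℤ) * (1 - T)) / T) *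
                      ((T / t) ^ (1 / (α + 2)) - 1))) ∧
            -- a positive semi-definite operator of trace one
            -- (orthogonality of the functions `f j` is not required)
            (∀ (p : ℕ → ℝ) (f : ℕ → ℂ → ℂ), (∀ j, 0 ≤ p j) → HasSum p 1 →
              (∀ j, MemBergman α (f j)) → (∀ j, bergmanNorm α (f j) = 1) →
              ∀ T : ℝ, IsGreatest (covariantSymbol α p f '' unitDisk) T → T₀ ≤ T →
                ∀ t : ℝ, t₀ < t → t < T →
                  superlevelMeasure (covariantSymbol α p f) t ≤
                    ENNReal.ofReal (Real.pi * ((1 + C * t₀ ^ (-3 : ℤ) * (1 - T)) / T) *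
                      ((T / t) ^ (1 / (α + 2)) - 1))) := by
  -- In `T₀` the first entry of the maximum ensures `T₀ > t₀`; the second is equivalent to `36 (1 -
  -- T) / T ≤ t₀²` for `T ≥ T₀`, which is the condition `6 δ ≤ s` in squared form.
  refine ⟨14, by norm_num, fun t₀ ht₀ ht₁ =>
    ⟨max ((1 + t₀) / 2) (1 / (1 + t₀ ^ 2 / 36)), ?_, ?_, fun α hα => ?_⟩⟩
  · exact lt_max_of_lt_left (by linarith)
  · refine max_lt (by linarith) ?_
    rw [div_lt_one (by positivity)]
    have : 0 < t₀ ^ 2 := by positivity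
    linarith
  have key : ∀ (p : ℕ → ℝ) (f : ℕ → ℂ → ℂ), (∀ j, 0 ≤ p j) → HasSum p 1 →
      (∀ j, MemBergman α (f j)) → (∀ j, bergmanNorm α (f j) = 1) →
      ∀ T : ℝ, IsGreatest (covariantSymbol α p f '' unitDisk) T →
        max ((1 + t₀) / 2) (1 / (1 + t₀ ^ 2 / 36)) ≤ T → ∀ t : ℝ, t₀ < t → t < T →
          superlevelMeasure (covariantSymbol α p f) t ≤
            ENNReal.ofReal (Real.pi * ((1 + 14 * t₀ ^ (-3 : ℤ) * (1 - T)) / T) *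
              ((T / t) ^ (1 / (α + 2)) - 1)) := by
    intro p f hp hp1 hf hn T hT hT₀ t ht htT
    have ht0 : 0 < t := ht₀.trans ht
    have hTpos : 0 < T := ht0.trans htT
    have hT₀' := (le_max_right _ _).trans hT₀
    rw [div_le_iff₀ (by positivity)] at hT₀'
    obtain ⟨hT1, h⟩ := superlevelMeasure_covariantSymbol_le hα hp hp1 hf hn hT ht0 htT
      (fun hT1 => by
        have h1 : 36 * ((1 - T) / T) ≤ t₀ ^ 2 := by
          rw [← mul_div_assoc, div_le_iff₀ hTpos]; linarith
        refine h1.trans ?_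
        have h2 : t ≤ t / T := by
          rw [le_div_iff₀ hTpos]; exact mul_le_of_le_one_right ht0.le hT1
        have : t₀ ≤ t / T := ht.le.trans h2
        gcongr)
    refine h.trans (ENNReal.ofReal_le_ofReal ?_)
    have hpow : 0 ≤ (T / t) ^ (1 / (α + 2)) - 1 := by
      have : 1 ≤ (T / t) ^ (1 / (α + 2)) := Real.one_le_rpow ((one_le_div ht0).2 htT.le)
        (div_nonneg zero_le_one (by linarith))
      linarith
    refine mul_le_mul_of_nonneg_right (mul_le_mul_of_nonneg_left ?_ Real.pi_pos.le) hpow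
    have hT' : 0 ≤ 1 - T := by linarith
    have e1 : 14 * ((1 - T) / T) / (t / T) ^ 2 = 14 * (1 - T) * (T / t ^ 2) := by field_simp
    -- Since `T ≤ 1`, already `T / t² ≤ t₀⁻²`; the cubic power is weaker because `t₀ < 1`.
    have e2 : T / t ^ 2 ≤ t₀ ^ (-3 : ℤ) := by
      rw [zpow_neg, div_le_iff₀ (by positivity), ← div_eq_inv_mul]
      rw [show t₀ ^ (3 : ℤ) = t₀ ^ 3 by norm_cast, le_div_iff₀ (by positivity)]
      have h3 : t₀ ^ 3 ≤ t₀ ^ 2 := pow_le_pow_of_le_one ht₀.le ht₁.le (by norm_num)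
      have h4 : t₀ ^ 2 ≤ t ^ 2 := by gcongr
      have h5 : T * t₀ ^ 3 ≤ t₀ ^ 3 := mul_le_of_le_one_left (by positivity) hT1
      linarith
    rw [e1]
    have h6 := mul_le_mul_of_nonneg_left e2 (by positivity : 0 ≤ 14 * (1 - T))
    have h7 : 0 ≤ 14 * t₀ ^ (-3 : ℤ) * (1 - T) := by positivity
    -- The estimate holds even without the factor `1 / T`, which only enlarges the bound as `T ≤ 1`.
    refine le_trans (b := 1 + 14 * t₀ ^ (-3 : ℤ) * (1 - T)) (by linarith) ?_
    rw [le_div_iff₀ hTpos]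
    exact mul_le_of_le_one_right (by linarith) hT1
  refine ⟨fun f hf hn T hT hT₀ t ht htT => ?_, key⟩
  have h := key (Pi.single 0 1) (fun _ => f)
    (fun j => by by_cases hj : j = 0 <;> simp [hj])
    (hasSum_pi_single 0 1) (fun _ => hf) (fun _ => hn) T
  rw [covariantSymbol_single] at h
  exact h hT hT₀ t ht htT
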